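/- For a finite graph $H$ let $\nu(H)$ be the maximum size of a set of pairwise edge-disjoint triangles of $H$. Let $p=p(n)\in[0,1]$, let $G_{n,p}$ be the binomial random graph on $n$ labelled vertices (each of the $\binom n2$ possible edges is present independently with probability $p$), and put $$d=d(n)=(n-2)p^2,\qquad m=m(n)=\binom n2 p,\qquad \xi(x)=\tfrac13\left[1-(2x+1)^{-1/2}\right].$$ If $d=\Theta(1)$ as $n\to\infty$ (that is, there are constants $0<c\le C$ with $c\le d(n)\le C$ for all sufficiently large $n$), then with high probability $$\nu(G_{n,p})>(1-o(1))\,\xi(d)\,m;$$ that is, there is a sequence $\delta_n\to0$ such that $\Pr\bigl[\nu(G_{n,p})>(1-\delta_n)\,\xi(d(n))\,m(n)\bigr]\to1$ as $n\to\infty$. -/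

import Mathlib

open Filter Topology Asymptotics

/-- A triangle-matching of `G`: a finite set `M` of triangles of `G` (each given by its set of
three pairwise adjacent vertices) that are pairwise edge-disjoint, i.e. two distinct members of
`M` have at most one vertex in common. -/
def SimpleGraph.IsTriangleMatching {V : Type*} (G : SimpleGraph V) (M : Finset (Finset V)) :
    Prop :=
  (∀ t ∈ M, G.IsNClique 3 t) ∧
    (M : Set (Finset V)).Pairwise fun s t => ((s : Set V) ∩ (t : Set V)).Subsingleton

/-- `ν(G)`, the maximum size of a set of edge-disjoint triangles of the finite graph `G`. -/
noncomputable def SimpleGraph.triangleMatchingNumber {V : Type*} (G : SimpleGraph V) : ℕ :=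
  sSup {k : ℕ | ∃ M : Finset (Finset V), G.IsTriangleMatching M ∧ M.card = k}

/-- On a finite vertex set the supremum defining `ν(G)` is a maximum. -/
theorem SimpleGraph.isGreatest_triangleMatchingNumber {V : Type*} [Finite V]
    (G : SimpleGraph V) :
    IsGreatest {k : ℕ | ∃ M : Finset (Finset V), G.IsTriangleMatching M ∧ M.card = k}
      G.triangleMatchingNumber := by
  have := Fintype.ofFinite V
  have hb : BddAbove {k : ℕ | ∃ M : Finset (Finset V), G.IsTriangleMatching M ∧ M.card = k} := by
    refine ⟨Fintype.card (Finset V), ?_⟩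
    rintro k ⟨M, -, rfl⟩
    exact Finset.card_le_univ M
  have hne : {k : ℕ | ∃ M : Finset (Finset V), G.IsTriangleMatching M ∧ M.card = k}.Nonempty :=
    ⟨0, ∅, ⟨by simp, by simp⟩, rfl⟩
  exact ⟨Nat.sSup_mem hne hb, fun k hk => le_csSup hb hk⟩

/-- `d = (n - 2) p²`, the expected number of triangles of `G(n, p)` on a given edge. -/
def expectedTrianglesOnEdge (n : ℕ) (p : ℝ) : ℝ := ((n : ℝ) - 2) * p ^ 2

/-- `m = C(n, 2) p`, the expected number of edges of `G(n, p)`. -/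
def expectedEdges (n : ℕ) (p : ℝ) : ℝ := (n.choose 2 : ℝ) * p

/-- `ξ(d) = (1/3) [1 - (2d + 1)^(-1/2)]`. -/
noncomputable def xi (d : ℝ) : ℝ := (1 / 3 : ℝ) * (1 - (2 * d + 1) ^ (-(1 / 2) : ℝ))

/-! Consider a greedy process on the random edge set: at each step one of the `N = n.choose 3`
triangles of the complete graph is drawn uniformly, with replacement, and its three edges are
deleted if all are still present. The deleted triangles are edge-disjoint, so the expectation of `ν`
is at least a third of the expected number of deleted edges (`expected_removed_le`). It remains to
see that a present edge survives a long run with probability at most about `(1 + 2d)^(-1/2)`.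

The survival probabilities of edge sets `S` satisfy an exact linear recursion (`survival_succ`):
drawing `T` destroys `S` exactly when `T` meets `S` and `S ∪ T` is still present. All but `O(|S|³)`
of the triangles meeting `S` are pendant: they share one edge with `S`, bring two new ones and close
no further triangle. After division by `p^|S|`, and with time `t = i / N`, the recursion is
therefore nearly solved by `f(t)^|S| * e^(-t * τ)`, with `τ` the number of triangles inside `S`,
none of which may have been drawn. Here `f' = -d e^(-t) f³`, that is `f^(-2) = 1 + 2d(1 - e^(-t))`,
which tends to `1 + 2d`.

The recursion does not close, since sets of size `k` involve sets of size `k + 2`. Errors never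
exceed one, however, and a supersolution geometric in `k`
(`IsLinearTripleSystem.survivalError_block`) turns error `2^(-3K)` for sizes below `3K` into error
`2^(-K)` for sizes below `K` over a time block of constant length. A fixed number of blocks
suffices, so only sets of bounded size matter while `p → 0` and `N → ∞`.

Finally, one edge changes `ν` by at most one, so Efron–Stein bounds the variance by `m`, and
Chebyshev's inequality gives concentration because `m → ∞`. -/

/-! ### Random subsets: expectation, variance and lower tail. -/

section BernoulliSum

variable {α : Type*} [DecidableEq α]

/-- The expectation of `F` over a random subset of `X` containing each element independently with
probability `p`. -/
noncomputable def bernoulliSum (p : ℝ) (X : Finset α) (F : Finset α → ℝ) : ℝ :=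
  ∑ A ∈ X.powerset, p ^ A.card * (1 - p) ^ (X \ A).card * F A

theorem bernoulliSum_empty (p : ℝ) (F : Finset α → ℝ) : bernoulliSum p ∅ F = F ∅ := by
  simp [bernoulliSum]

/-- Conditioning on whether `x` is chosen; this drives the inductions on `X`. -/
theorem bernoulliSum_insert (p : ℝ) {X : Finset α} {x : α} (hx : x ∉ X) (F : Finset α → ℝ) :
    bernoulliSum p (insert x X) F =
      p * bernoulliSum p X (fun A => F (insert x A)) + (1 - p) * bernoulliSum p X F := by
  unfold bernoulliSum
  rw [Finset.sum_powerset_insert hx, add_comm, Finset.mul_sum, Finset.mul_sum]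
  congr 1
  · refine Finset.sum_congr rfl fun A hA => ?_
    have hA' := Finset.mem_powerset.1 hA
    have hxA : x ∉ A := fun h => hx (hA' h)
    rw [Finset.card_insert_of_notMem hxA, Finset.insert_sdiff_insert,
      Finset.sdiff_insert_of_notMem hx]
    ring
  · refine Finset.sum_congr rfl fun A hA => ?_
    have hA' := Finset.mem_powerset.1 hA
    have hxA : x ∉ A := fun h => hx (hA' h)
    rw [Finset.insert_sdiff_of_notMem _ hxA, Finset.card_insert_of_notMem (by simp [hx])]
    ring

theorem bernoulliSum_mono {p : ℝ} (h0 : 0 ≤ p) (h1 : p ≤ 1) {X : Finset α} {F F' : Finset α → ℝ}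
    (h : ∀ A ⊆ X, F A ≤ F' A) : bernoulliSum p X F ≤ bernoulliSum p X F' := by
  refine Finset.sum_le_sum fun A hA => ?_
  have := sub_nonneg.2 h1
  exact mul_le_mul_of_nonneg_left (h A (Finset.mem_powerset.1 hA)) (by positivity)

theorem bernoulliSum_const (p c : ℝ) (X : Finset α) : bernoulliSum p X (fun _ => c) = c := by
  induction X using Finset.induction_on with
  | empty => simp [bernoulliSum_empty]
  | insert x X hx ih => rw [bernoulliSum_insert p hx, ih]; ring

theorem bernoulliSum_nonneg {p : ℝ} (h0 : 0 ≤ p) (h1 : p ≤ 1) {X : Finset α} {F : Finset α → ℝ}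
    (h : ∀ A ⊆ X, 0 ≤ F A) : 0 ≤ bernoulliSum p X F := by
  simpa [bernoulliSum_const] using bernoulliSum_mono (F := fun _ => 0) h0 h1 h

theorem bernoulliSum_add (p : ℝ) (X : Finset α) (F F' : Finset α → ℝ) :
    bernoulliSum p X (fun A => F A + F' A) = bernoulliSum p X F + bernoulliSum p X F' := by
  simp [bernoulliSum, mul_add, Finset.sum_add_distrib]

theorem bernoulliSum_sub (p : ℝ) (X : Finset α) (F F' : Finset α → ℝ) :
    bernoulliSum p X (fun A => F A - F' A) = bernoulliSum p X F - bernoulliSum p X F' := by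
  simp [bernoulliSum, mul_sub, Finset.sum_sub_distrib]

theorem bernoulliSum_const_mul (p c : ℝ) (X : Finset α) (F : Finset α → ℝ) :
    bernoulliSum p X (fun A => c * F A) = c * bernoulliSum p X F := by
  simp only [bernoulliSum, Finset.mul_sum]
  exact Finset.sum_congr rfl fun A _ => by ring

theorem bernoulliSum_sum {ι : Type*} (p : ℝ) (X : Finset α) (s : Finset ι)
    (F : ι → Finset α → ℝ) :
    bernoulliSum p X (fun A => ∑ i ∈ s, F i A) = ∑ i ∈ s, bernoulliSum p X (F i) := by
  simp only [bernoulliSum, Finset.mul_sum]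
  exact Finset.sum_comm

/-- The probability that a random subset contains a given set. -/
theorem bernoulliSum_subset (p : ℝ) (X S : Finset α) (hS : S ⊆ X) :
    bernoulliSum p X (fun A => if S ⊆ A then 1 else 0) = p ^ S.card := by
  induction X using Finset.induction_on generalizing S with
  | empty => simp [bernoulliSum_empty, Finset.subset_empty.1 hS]
  | insert x X hx ih =>
    rw [bernoulliSum_insert p hx]
    by_cases hxS : x ∈ S
    · have h1 : bernoulliSum p X (fun A => if S ⊆ A then (1 : ℝ) else 0) = 0 := by
        refine Finset.sum_eq_zero fun A hA => ?_
        have : ¬ S ⊆ A := fun h => hx (Finset.mem_powerset.1 hA (h hxS))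
        simp [this]
      have h2 : ∀ A, S ⊆ insert x A ↔ S.erase x ⊆ A := fun A => Finset.subset_insert_iff
      simp only [h1, h2]
      rw [ih _ (Finset.subset_insert_iff.1 hS)]
      rw [← Finset.card_erase_add_one hxS]
      ring
    · have h2 : ∀ A, S ⊆ insert x A ↔ S ⊆ A := fun A =>
        Finset.subset_insert_iff_of_notMem hxS
      simp only [h2]
      rw [ih S ((h2 X).1 hS)]
      ring

theorem bernoulliSum_card (p : ℝ) (X : Finset α) :
    bernoulliSum p X (fun A => (A.card : ℝ)) = X.card * p := by
  have : bernoulliSum p X (fun A => (A.card : ℝ)) =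
      bernoulliSum p X (fun A => ∑ x ∈ X, if {x} ⊆ A then (1 : ℝ) else 0) := by
    refine Finset.sum_congr rfl fun A hA => ?_
    congr 1
    have hA' := Finset.mem_powerset.1 hA
    simp [Finset.sum_ite_mem, Finset.inter_eq_right.2 hA']
  rw [this, bernoulliSum_sum, Finset.sum_congr rfl fun x hx =>
    bernoulliSum_subset p X {x} (Finset.singleton_subset_iff.2 hx)]
  simp

/-- The Efron–Stein inequality for a function on subsets that moves by at most one when an element
is added. -/
theorem bernoulliSum_variance_le {p : ℝ} (h0 : 0 ≤ p) (h1 : p ≤ 1) (X : Finset α)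
    (F : Finset α → ℝ) (hF : ∀ x ∈ X, ∀ A ⊆ X, |F (insert x A) - F A| ≤ 1) :
    bernoulliSum p X (fun A => F A ^ 2) - bernoulliSum p X F ^ 2 ≤ X.card * p := by
  induction X using Finset.induction_on generalizing F with
  | empty => simp [bernoulliSum_empty]
  | insert x X hx ih =>
    have hX : X ⊆ insert x X := Finset.subset_insert x X
    have e0 := ih F fun y hy A hA => hF y (hX hy) A (hA.trans hX)
    have e1 := ih (fun A => F (insert x A)) fun y hy A hA => by
      rw [Finset.insert_comm]
      exact hF y (hX hy) _ (Finset.insert_subset_insert x hA)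
    have e2 : |bernoulliSum p X (fun A => F (insert x A)) - bernoulliSum p X F| ≤ 1 := by
      rw [← bernoulliSum_sub, abs_le]
      have hA : ∀ A ⊆ X, |F (insert x A) - F A| ≤ 1 := fun A hA =>
        hF x (Finset.mem_insert_self x X) A (hA.trans hX)
      constructor
      · rw [← bernoulliSum_const p (-1) X]
        exact bernoulliSum_mono h0 h1 fun A h => (abs_le.1 (hA A h)).1
      · rw [← bernoulliSum_const p 1 X]
        exact bernoulliSum_mono h0 h1 fun A h => (abs_le.1 (hA A h)).2
    rw [bernoulliSum_insert p hx, bernoulliSum_insert p hx, Finset.card_insert_of_notMem hx]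
    set u := bernoulliSum p X (fun A => F (insert x A))
    set v := bernoulliSum p X F
    set u2 := bernoulliSum p X (fun A => F (insert x A) ^ 2)
    set v2 := bernoulliSum p X (fun A => F A ^ 2)
    have e3 : (u - v) ^ 2 ≤ 1 := by
      rw [sq_le_one_iff_abs_le_one]; exact e2
    -- Law of total variance over the choice of `x`: the last term is the variance between the two
    -- conditional means, which differ by at most one.
    have h3 : p * u2 + (1 - p) * v2 - (p * u + (1 - p) * v) ^ 2 =
        p * (u2 - u ^ 2) + (1 - p) * (v2 - v ^ 2) + p * (1 - p) * (u - v) ^ 2 := by ring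
    rw [h3]
    push_cast
    have a1 := mul_le_mul_of_nonneg_left e1 h0
    have a2 := mul_le_mul_of_nonneg_left e0 (sub_nonneg.2 h1)
    have a3 : p * (1 - p) * (u - v) ^ 2 ≤ p := by
      have : p * ((1 - p) * (u - v) ^ 2) ≤ p * 1 :=
        mul_le_mul_of_nonneg_left (mul_le_one₀ (by linarith) (sq_nonneg _) e3) h0
      linarith
    linarith

/-- Chebyshev's inequality (lower tail) for a function on subsets that moves by at most one when an
element is added. -/
theorem bernoulliSum_lower_tail {p : ℝ} (h0 : 0 ≤ p) (h1 : p ≤ 1) (X : Finset α)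
    (F : Finset α → ℝ) (hF : ∀ x ∈ X, ∀ A ⊆ X, |F (insert x A) - F A| ≤ 1) {s : ℝ} (hs : 0 < s) :
    bernoulliSum p X (fun A => if F A ≤ bernoulliSum p X F - s then 1 else 0) ≤
      X.card * p / s ^ 2 := by
  set μ := bernoulliSum p X F with hμ
  rw [le_div_iff₀ (by positivity), mul_comm, ← bernoulliSum_const_mul]
  calc _ ≤ bernoulliSum p X (fun A => (F A - μ) ^ 2) := by
        refine bernoulliSum_mono h0 h1 fun A _ => ?_
        split_ifs with h
        · nlinarith
        · simpa using sq_nonneg _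
    _ = bernoulliSum p X (fun A => F A ^ 2) - μ ^ 2 := by
        have : (fun A => (F A - μ) ^ 2) = fun A => (F A ^ 2 - (2 * μ) * F A) + μ ^ 2 := by
          funext A; ring
        rw [this, bernoulliSum_add, bernoulliSum_sub, bernoulliSum_const_mul, bernoulliSum_const,
          ← hμ]
        ring
    _ ≤ _ := bernoulliSum_variance_le h0 h1 X F hF

end BernoulliSum

/-! ### The greedy removal process and its survival probabilities. -/

section RandomGreedy

variable {α : Type*} [DecidableEq α]

/-- One step of the greedy removal process: delete the triple `T` if all of it is still there. -/
def removeTriple (T A : Finset α) : Finset α := if T ⊆ A then A \ T else A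

/-- The expectation of `F` after removing a uniformly random member of `𝒯` from `A`, if possible. -/
noncomputable def averageStep (𝒯 : Finset (Finset α)) (F : Finset α → ℝ) (A : Finset α) : ℝ :=
  (∑ T ∈ 𝒯, F (removeTriple T A)) / 𝒯.card

/-- The indicator of containing `S`. -/
noncomputable def containsIndicator (S A : Finset α) : ℝ := if S ⊆ A then 1 else 0

/-- The probability that `S` survives `i` steps of the greedy removal process started from a random
subset of `X`. -/
noncomputable def survival (p : ℝ) (X : Finset α) (𝒯 : Finset (Finset α)) (i : ℕ)
    (S : Finset α) : ℝ :=
  bernoulliSum p X ((averageStep 𝒯)^[i] (containsIndicator S))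

variable {p : ℝ} {X : Finset α} {𝒯 : Finset (Finset α)}

theorem averageStep_mono {F F' : Finset α → ℝ} (h : F ≤ F') :
    averageStep 𝒯 F ≤ averageStep 𝒯 F' := fun A => by
  unfold averageStep
  gcongr
  exact h _

theorem iterate_averageStep_mono {F F' : Finset α → ℝ} (h : F ≤ F') (i : ℕ) :
    (averageStep 𝒯)^[i] F ≤ (averageStep 𝒯)^[i] F' :=
  Monotone.iterate (fun _ _ h => averageStep_mono h) i h

theorem averageStep_sub (F F' : Finset α → ℝ) :
    averageStep 𝒯 (F - F') = averageStep 𝒯 F - averageStep 𝒯 F' := by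
  funext A
  simp [averageStep, sub_div]

theorem averageStep_smul (c : ℝ) (F : Finset α → ℝ) :
    averageStep 𝒯 (c • F) = c • averageStep 𝒯 F := by
  funext A
  simp [averageStep, ← Finset.mul_sum, mul_div_assoc]

theorem averageStep_sum {ι : Type*} (s : Finset ι) (F : ι → Finset α → ℝ) :
    averageStep 𝒯 (∑ j ∈ s, F j) = ∑ j ∈ s, averageStep 𝒯 (F j) := by
  funext A
  simp only [averageStep, Finset.sum_apply]
  rw [Finset.sum_comm, Finset.sum_div]

theorem iterate_averageStep_sub (i : ℕ) (F F' : Finset α → ℝ) :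
    (averageStep 𝒯)^[i] (F - F') = (averageStep 𝒯)^[i] F - (averageStep 𝒯)^[i] F' := by
  induction i generalizing F F' with
  | zero => rfl
  | succ i ih => simp only [Function.iterate_succ_apply, averageStep_sub, ih]

theorem iterate_averageStep_smul (i : ℕ) (c : ℝ) (F : Finset α → ℝ) :
    (averageStep 𝒯)^[i] (c • F) = c • (averageStep 𝒯)^[i] F := by
  induction i generalizing F with
  | zero => rfl
  | succ i ih => simp only [Function.iterate_succ_apply, averageStep_smul, ih]

theorem iterate_averageStep_sum {ι : Type*} (i : ℕ) (s : Finset ι) (F : ι → Finset α → ℝ) :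
    (averageStep 𝒯)^[i] (∑ j ∈ s, F j) = ∑ j ∈ s, (averageStep 𝒯)^[i] (F j) := by
  induction i generalizing F with
  | zero => rfl
  | succ i ih => simp only [Function.iterate_succ_apply, averageStep_sum, ih]

theorem containsIndicator_nonneg (S : Finset α) : 0 ≤ containsIndicator S := fun A => by
  unfold containsIndicator
  split_ifs <;> simp

/-- `S` is lost precisely when `S` and `T` are both present and intersect. Since the loss is again a
containment indicator, the survival recursion is linear and exact. -/
theorem containsIndicator_removeTriple (S T A : Finset α) :
    containsIndicator S (removeTriple T A) =
      containsIndicator S A - if (T ∩ S).Nonempty then containsIndicator (S ∪ T) A else 0 := by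
  unfold containsIndicator removeTriple
  by_cases hT : T ⊆ A
  · by_cases hS : S ⊆ A
    · by_cases hI : (T ∩ S).Nonempty
      · have : ¬ S ⊆ A \ T := fun h => by
          obtain ⟨x, hx⟩ := hI
          rw [Finset.mem_inter] at hx
          exact (Finset.mem_sdiff.1 (h hx.2)).2 hx.1
        simp [hT, hS, hI, this, Finset.union_subset hS hT]
      · have : S ⊆ A \ T := Finset.subset_sdiff.2 ⟨hS, by
          rw [disjoint_comm, Finset.disjoint_iff_inter_eq_empty]
          exact Finset.not_nonempty_iff_eq_empty.1 hI⟩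
        simp [hT, hS, hI, this]
    · have h1 : ¬ S ⊆ A \ T := fun h => hS (h.trans Finset.sdiff_subset)
      have h2 : ¬ S ∪ T ⊆ A := fun h => hS (Finset.subset_union_left.trans h)
      simp [hT, hS, h1, h2]
  · have h2 : ¬ S ∪ T ⊆ A := fun h => hT (Finset.subset_union_right.trans h)
    simp [hT, h2]

theorem averageStep_containsIndicator (h𝒯 : 𝒯.Nonempty) (S : Finset α) :
    averageStep 𝒯 (containsIndicator S) = containsIndicator S -
      (𝒯.card : ℝ)⁻¹ • ∑ T ∈ 𝒯 with (T ∩ S).Nonempty, containsIndicator (S ∪ T) := by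
  funext A
  have hN : (𝒯.card : ℝ) ≠ 0 := by exact_mod_cast h𝒯.card_pos.ne'
  simp only [averageStep, containsIndicator_removeTriple, Finset.sum_sub_distrib, Pi.sub_apply,
    Pi.smul_apply, Finset.sum_apply, smul_eq_mul, Finset.sum_const, nsmul_eq_mul, ← Finset.sum_filter]
  field_simp

/-- The exact recursion for the survival probabilities. -/
theorem survival_succ (h𝒯 : 𝒯.Nonempty) (i : ℕ) (S : Finset α) :
    survival p X 𝒯 (i + 1) S = survival p X 𝒯 i S -
      (𝒯.card : ℝ)⁻¹ * ∑ T ∈ 𝒯 with (T ∩ S).Nonempty, survival p X 𝒯 i (S ∪ T) := by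
  unfold survival
  rw [Function.iterate_succ_apply, averageStep_containsIndicator h𝒯, iterate_averageStep_sub,
    iterate_averageStep_smul, iterate_averageStep_sum]
  have h1 := bernoulliSum_sub p X ((averageStep 𝒯)^[i] (containsIndicator S))
    ((𝒯.card : ℝ)⁻¹ • ∑ T ∈ 𝒯 with (T ∩ S).Nonempty,
      (averageStep 𝒯)^[i] (containsIndicator (S ∪ T)))
  have h2 := bernoulliSum_const_mul p (𝒯.card : ℝ)⁻¹ X
    (∑ T ∈ 𝒯 with (T ∩ S).Nonempty, (averageStep 𝒯)^[i] (containsIndicator (S ∪ T)))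
  have h3 := bernoulliSum_sum p X {T ∈ 𝒯 | (T ∩ S).Nonempty}
    fun T => (averageStep 𝒯)^[i] (containsIndicator (S ∪ T))
  rw [← h3]
  refine h1.trans ?_
  congr 1
  refine h2.trans ?_
  congr 2
  funext A
  simp

theorem survival_zero {S : Finset α} (hS : S ⊆ X) : survival p X 𝒯 0 S = p ^ S.card :=
  bernoulliSum_subset p X S hS

theorem survival_nonneg (h0 : 0 ≤ p) (h1 : p ≤ 1) (i : ℕ) (S : Finset α) :
    0 ≤ survival p X 𝒯 i S := by
  refine bernoulliSum_nonneg h0 h1 fun A _ => ?_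
  have h : (averageStep 𝒯)^[i] 0 = 0 := by
    induction i with
    | zero => rfl
    | succ i ih =>
      rw [Function.iterate_succ_apply, show averageStep 𝒯 (0 : Finset α → ℝ) = 0 from ?_, ih]
      funext A
      simp [averageStep]
  have := iterate_averageStep_mono (𝒯 := 𝒯) (containsIndicator_nonneg S) i A
  rwa [h] at this

theorem survival_le (h0 : 0 ≤ p) (h1 : p ≤ 1) (h𝒯 : 𝒯.Nonempty) (i : ℕ) {S : Finset α}
    (hS : S ⊆ X) : survival p X 𝒯 i S ≤ p ^ S.card := by
  induction i with
  | zero => rw [survival_zero hS]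
  | succ i ih =>
    rw [survival_succ h𝒯]
    have : 0 ≤ (𝒯.card : ℝ)⁻¹ * ∑ T ∈ 𝒯 with (T ∩ S).Nonempty, survival p X 𝒯 i (S ∪ T) :=
      mul_nonneg (by positivity) (Finset.sum_nonneg fun T _ => survival_nonneg h0 h1 i _)
    linarith

/-- A function `ν` which grows by one whenever a triple of `𝒯` is added is at least a third of the
expected number of elements removed by the greedy process. -/
theorem expected_removed_le (h0 : 0 ≤ p) (h1 : p ≤ 1) (h𝒯 : 𝒯.Nonempty)
    (h3 : ∀ T ∈ 𝒯, T.card = 3) {ν : Finset α → ℝ} (hν : ∀ A, 0 ≤ ν A)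
    (hνT : ∀ A, ∀ T ∈ 𝒯, T ⊆ A → ν (A \ T) + 1 ≤ ν A) (i : ℕ) :
    X.card * p - ∑ x ∈ X, survival p X 𝒯 i {x} ≤ 3 * bernoulliSum p X ν := by
  have hN : (0 : ℝ) < 𝒯.card := by exact_mod_cast h𝒯.card_pos
  -- A removal costs at most three elements and lowers `ν` by at least one, so `ψ` never decreases
  -- along the process. At the end it is at most the number of surviving elements, as `ν ≥ 0`.
  set ψ : Finset α → ℝ := fun A => ((X ∩ A).card : ℝ) - 3 * ν A with hψ
  have hstep : ψ ≤ averageStep 𝒯 ψ := fun A => by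
    rw [averageStep, le_div_iff₀ hN, mul_comm, ← nsmul_eq_mul]
    refine Finset.card_nsmul_le_sum _ _ _ fun T hT => ?_
    unfold removeTriple
    split_ifs with h
    · have e1 := hνT A T hT h
      have e2 : (X ∩ A).card ≤ (X ∩ (A \ T)).card + 3 := by
        rw [← h3 T hT, ← Finset.inter_sdiff_assoc]
        have := Finset.le_card_sdiff T (X ∩ A)
        omega
      have e3 : ((X ∩ A).card : ℝ) ≤ (X ∩ (A \ T)).card + 3 := by exact_mod_cast e2
      simp only [hψ]
      linarith
    · exact le_rfl
  have hiter : ψ ≤ (averageStep 𝒯)^[i] ψ := by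
    induction i with
    | zero => exact le_rfl
    | succ i ih =>
      rw [Function.iterate_succ_apply]
      exact ih.trans (iterate_averageStep_mono hstep i)
  have hcard : ψ ≤ ∑ x ∈ X, containsIndicator {x} := fun A => by
    simp only [hψ, Finset.sum_apply, containsIndicator, Finset.singleton_subset_iff]
    rw [Finset.sum_ite_mem]
    simp only [Finset.sum_const, nsmul_eq_mul, mul_one]
    linarith [hν A]
  have hfin := hiter.trans (iterate_averageStep_mono (𝒯 := 𝒯) hcard i)
  rw [iterate_averageStep_sum] at hfin
  have key := bernoulliSum_mono h0 h1 (X := X) fun A _ => hfin A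
  have e1 : bernoulliSum p X ψ = X.card * p - 3 * bernoulliSum p X ν := by
    rw [← bernoulliSum_card, ← bernoulliSum_const_mul, ← bernoulliSum_sub]
    refine Finset.sum_congr rfl fun A hA => ?_
    rw [hψ]
    simp only [Finset.inter_eq_right.2 (Finset.mem_powerset.1 hA)]
  have e2 : bernoulliSum p X (∑ x ∈ X, (averageStep 𝒯)^[i] (containsIndicator {x})) =
      ∑ x ∈ X, survival p X 𝒯 i {x} := by
    unfold survival
    rw [← bernoulliSum_sum]
    congr 1
    funext A
    simp
  rw [e1, e2] at key
  linarith

end RandomGreedy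

/-! ### Counting the triples that meet a given set. -/

section LinearTripleSystem

variable {α : Type*} [DecidableEq α]

/-- A family `𝒯` of triples of elements of `X`, two distinct ones of which share at most one
element, such that every element of `X` lies in exactly `D` of them. -/
structure IsLinearTripleSystem (X : Finset α) (𝒯 : Finset (Finset α)) (D : ℕ) : Prop where
  subset : ∀ T ∈ 𝒯, T ⊆ X
  card_eq : ∀ T ∈ 𝒯, T.card = 3
  linear : ∀ T ∈ 𝒯, ∀ T' ∈ 𝒯, ∀ x y, x ≠ y → x ∈ T → y ∈ T → x ∈ T' → y ∈ T' → T = T'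
  degree : ∀ x ∈ X, ({T ∈ 𝒯 | x ∈ T} : Finset (Finset α)).card = D

/-- The number of triples of `𝒯` inside `S`. -/
def triplesInside (𝒯 : Finset (Finset α)) (S : Finset α) : ℕ := {T ∈ 𝒯 | T ⊆ S}.card

/-- The triple `T` meets `S` in one element and creates no further triple when added to `S`. -/
def IsPendant (𝒯 : Finset (Finset α)) (S T : Finset α) : Prop :=
  (T ∩ S).card = 1 ∧ triplesInside 𝒯 (S ∪ T) = triplesInside 𝒯 S + 1

instance (𝒯 : Finset (Finset α)) (S T : Finset α) : Decidable (IsPendant 𝒯 S T) :=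
  inferInstanceAs (Decidable (_ ∧ _))

theorem IsPendant.card_union {𝒯 : Finset (Finset α)} {S T : Finset α} (h : IsPendant 𝒯 S T)
    (hT : T.card = 3) : (S ∪ T).card = S.card + 2 := by
  have := Finset.card_union_add_card_inter S T
  have h1 := h.1
  rw [Finset.inter_comm] at h1
  omega

namespace IsLinearTripleSystem

variable {X : Finset α} {𝒯 : Finset (Finset α)} {D : ℕ}

theorem card_through_pair_le (h : IsLinearTripleSystem X 𝒯 D) (x y : α) :
    ({T ∈ 𝒯 | x ≠ y ∧ x ∈ T ∧ y ∈ T} : Finset (Finset α)).card ≤ 1 := by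
  refine Finset.card_le_one.2 fun T hT T' hT' => ?_
  simp only [Finset.mem_filter] at hT hT'
  exact h.linear T hT.1 T' hT'.1 x y hT.2.1 hT.2.2.1 hT.2.2.2 hT'.2.2.1 hT'.2.2.2

theorem card_two_le_inter_le (h : IsLinearTripleSystem X 𝒯 D) (S : Finset α) :
    ({T ∈ 𝒯 | 2 ≤ (T ∩ S).card} : Finset (Finset α)).card ≤ S.card ^ 2 := by
  calc _ ≤ ((S ×ˢ S).biUnion fun q => {T ∈ 𝒯 | q.1 ≠ q.2 ∧ q.1 ∈ T ∧ q.2 ∈ T}).card := by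
        refine Finset.card_le_card fun T hT => ?_
        rw [Finset.mem_filter] at hT
        obtain ⟨x, hx, y, hy, hxy⟩ := Finset.one_lt_card.1 (Nat.lt_of_succ_le hT.2)
        rw [Finset.mem_inter] at hx hy
        rw [Finset.mem_biUnion]
        exact ⟨(x, y), Finset.mem_product.2 ⟨hx.2, hy.2⟩,
          Finset.mem_filter.2 ⟨hT.1, hxy, hx.1, hy.1⟩⟩
    _ ≤ (S ×ˢ S).card * 1 :=
        Finset.card_biUnion_le_card_mul _ _ _ fun q _ => h.card_through_pair_le q.1 q.2
    _ = S.card ^ 2 := by rw [Finset.card_product]; ring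

theorem triplesInside_le (h : IsLinearTripleSystem X 𝒯 D) (S : Finset α) :
    triplesInside 𝒯 S ≤ S.card ^ 2 := by
  refine le_trans (Finset.card_le_card fun T hT => ?_) (h.card_two_le_inter_le S)
  rw [Finset.mem_filter] at hT ⊢
  refine ⟨hT.1, ?_⟩
  rw [Finset.inter_eq_left.2 hT.2, h.card_eq T hT.1]
  norm_num

/-- A triple meeting `S` in one element and not pendant is joined to the element it shares with `S`
by an element of another triple which meets `S` twice. -/
theorem exists_of_not_isPendant (h : IsLinearTripleSystem X 𝒯 D) {S T : Finset α} (hT : T ∈ 𝒯)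
    (h1 : (T ∩ S).card = 1) (hp : ¬ IsPendant 𝒯 S T) :
    ∃ T' ∈ 𝒯, 2 ≤ (T' ∩ S).card ∧ ∃ x ∈ T', x ∈ T ∧ x ∉ S := by
  have hTS : ¬ T ⊆ S := fun hs => by
    rw [Finset.inter_eq_left.2 hs, h.card_eq T hT] at h1
    omega
  have hsub : insert T {T ∈ 𝒯 | T ⊆ S} ⊆ {T' ∈ 𝒯 | T' ⊆ S ∪ T} := by
    intro T' hT'
    rw [Finset.mem_insert, Finset.mem_filter] at hT'
    rw [Finset.mem_filter]
    rcases hT' with rfl | hT'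
    · exact ⟨hT, Finset.subset_union_right⟩
    · exact ⟨hT'.1, hT'.2.trans Finset.subset_union_left⟩
  have hne : ¬ {T' ∈ 𝒯 | T' ⊆ S ∪ T} ⊆ insert T {T ∈ 𝒯 | T ⊆ S} := fun hs => by
    refine hp ⟨h1, ?_⟩
    unfold triplesInside
    rw [hs.antisymm hsub, Finset.card_insert_of_notMem (by simp [hTS])]
  obtain ⟨T', hT', hT'2⟩ := Finset.not_subset.1 hne
  rw [Finset.mem_filter] at hT'
  simp only [Finset.mem_insert, Finset.mem_filter, not_or, not_and] at hT'2
  obtain ⟨x, hxT', hxS⟩ := Finset.not_subset.1 (hT'2.2 hT'.1)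
  have hxT : x ∈ T := (Finset.mem_union.1 (hT'.2 hxT')).resolve_left hxS
  refine ⟨T', hT'.1, ?_, x, hxT', hxT, hxS⟩
  -- By linearity `T'` meets `T` only in `x`, so its other two elements lie in `S`.
  have hsub2 : T'.erase x ⊆ T' ∩ S := fun y hy => by
    rw [Finset.mem_erase] at hy
    refine Finset.mem_inter.2 ⟨hy.2, (Finset.mem_union.1 (hT'.2 hy.2)).resolve_right fun hyT => ?_⟩
    exact hT'2.1 (h.linear T' hT'.1 T hT y x hy.1 hy.2 hxT' hyT hxT)
  have := Finset.card_le_card hsub2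
  rw [Finset.card_erase_of_mem hxT', h.card_eq T' hT'.1] at this
  exact this

/-- Put `k = S.card`. At most `k²` triples meet `S` twice. Any other non-pendant triple meeting `S`
is determined by an element of `S` and an element of one of those triples, which leaves at most `k *
k² * 3` choices. -/
theorem card_not_isPendant_le (h : IsLinearTripleSystem X 𝒯 D) {S : Finset α} (hS : S.Nonempty) :
    ({T ∈ 𝒯 | (T ∩ S).Nonempty ∧ ¬ IsPendant 𝒯 S T} : Finset (Finset α)).card ≤
      4 * S.card ^ 3 := by
  set B : Finset (Finset α) := {T ∈ 𝒯 | 2 ≤ (T ∩ S).card} with hB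
  have hBcard : B.card ≤ S.card ^ 2 := h.card_two_le_inter_le S
  set P : Finset (Finset α) := S.biUnion fun s => B.biUnion fun T' => T'.biUnion fun x =>
    {T ∈ 𝒯 | s ≠ x ∧ s ∈ T ∧ x ∈ T} with hP
  have hsub : ({T ∈ 𝒯 | (T ∩ S).Nonempty ∧ ¬ IsPendant 𝒯 S T} : Finset (Finset α)) ⊆ B ∪ P := by
    intro T hT
    rw [Finset.mem_filter] at hT
    obtain ⟨hT, hne, hp⟩ := hT
    rw [Finset.mem_union]
    by_cases h2 : 2 ≤ (T ∩ S).card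
    · exact Or.inl (Finset.mem_filter.2 ⟨hT, h2⟩)
    · right
      have h1 : (T ∩ S).card = 1 := by have := hne.card_pos; omega
      obtain ⟨T', hT', h2', x, hxT', hxT, hxS⟩ := h.exists_of_not_isPendant hT h1 hp
      obtain ⟨s, hs⟩ := hne
      rw [Finset.mem_inter] at hs
      simp only [hP, Finset.mem_biUnion]
      exact ⟨s, hs.2, T', Finset.mem_filter.2 ⟨hT', h2'⟩, x, hxT', Finset.mem_filter.2
        ⟨hT, fun e => hxS (e ▸ hs.2), hs.1, hxT⟩⟩
  have hPcard : P.card ≤ S.card * (S.card ^ 2 * (3 * 1)) := by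
    refine Finset.card_biUnion_le_card_mul _ _ _ fun s _ => ?_
    refine le_trans (Finset.card_biUnion_le_card_mul _ _ (3 * 1) fun T' hT' => ?_)
      (Nat.mul_le_mul_right _ hBcard)
    rw [← h.card_eq T' (Finset.mem_filter.1 hT').1]
    exact Finset.card_biUnion_le_card_mul _ _ _ fun x _ => h.card_through_pair_le s x
  have hk : 1 ≤ S.card := hS.card_pos
  calc _ ≤ (B ∪ P).card := Finset.card_le_card hsub
    _ ≤ B.card + P.card := Finset.card_union_le _ _
    _ ≤ S.card ^ 2 * 1 + S.card * (S.card ^ 2 * (3 * 1)) := by omega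
    _ ≤ S.card ^ 2 * S.card + S.card * (S.card ^ 2 * (3 * 1)) := by gcongr
    _ = _ := by ring

theorem card_isPendant_le (h : IsLinearTripleSystem X 𝒯 D) {S : Finset α} (hS : S ⊆ X) :
    ({T ∈ 𝒯 | IsPendant 𝒯 S T} : Finset (Finset α)).card ≤ S.card * D := by
  rw [← Finset.sum_card_inter fun x hx => h.degree x (hS hx), Finset.card_filter]
  refine Finset.sum_le_sum fun T _ => ?_
  split_ifs with hp
  · rw [Finset.inter_comm, hp.1]
  · exact Nat.zero_le _

/-- The `S.card * D` incidences between `S` and `𝒯` are split: a pendant triple accounts for one,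
each of the at most `4 * S.card ^ 3` other triples meeting `S` for at most three. -/
theorem le_card_isPendant (h : IsLinearTripleSystem X 𝒯 D) {S : Finset α} (hS : S ⊆ X)
    (hne : S.Nonempty) :
    S.card * D ≤ ({T ∈ 𝒯 | IsPendant 𝒯 S T} : Finset (Finset α)).card + 12 * S.card ^ 3 := by
  have hb := h.card_not_isPendant_le hne
  have : S.card * D ≤ ({T ∈ 𝒯 | IsPendant 𝒯 S T} : Finset (Finset α)).card +
      3 * ({T ∈ 𝒯 | (T ∩ S).Nonempty ∧ ¬ IsPendant 𝒯 S T} : Finset (Finset α)).card := by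
    rw [← Finset.sum_card_inter fun x hx => h.degree x (hS hx), Finset.card_filter,
      Finset.card_filter, Finset.mul_sum, ← Finset.sum_add_distrib]
    refine Finset.sum_le_sum fun T hT => ?_
    rw [Finset.inter_comm]
    by_cases hp : IsPendant 𝒯 S T
    · simp [hp, hp.1]
    · by_cases hn : (T ∩ S).Nonempty
      · have := Finset.card_le_card (Finset.inter_subset_left : T ∩ S ⊆ T)
        rw [h.card_eq T hT] at this
        simpa [hp, hn] using this
      · simp [hp, Finset.not_nonempty_iff_eq_empty.1 hn]
  omega

theorem three_mul_card (h : IsLinearTripleSystem X 𝒯 D) : 3 * 𝒯.card = X.card * D := by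
  rw [← Finset.sum_card_inter h.degree, Finset.sum_congr rfl fun T hT => by
    rw [Finset.inter_eq_right.2 (h.subset T hT), h.card_eq T hT]]
  simp [mul_comm]

end IsLinearTripleSystem

end LinearTripleSystem

/-! ### The limiting hierarchy and the one-step error estimate. -/

section SurvivalLimit

/-- The discrete solution of `f' = -d e⁻ᵗ f³` with `f(0) = 1`, with step `1 / N`. -/
noncomputable def aliveDensity (d N : ℝ) : ℕ → ℝ
  | 0 => 1
  | i + 1 => aliveDensity d N i * (1 - d / N * (1 - 1 / N) ^ i * aliveDensity d N i ^ 2)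

theorem aliveDensity_mem {d N : ℝ} (hd : 0 ≤ d) (hdN : d ≤ N) (hN : 1 ≤ N) (i : ℕ) :
    0 ≤ aliveDensity d N i ∧ aliveDensity d N i ≤ 1 := by
  have hN0 : 0 < N := by linarith
  have h1 : 1 / N ≤ 1 := by rw [div_le_one hN0]; exact hN
  have h2 : 0 ≤ 1 / N := by positivity
  have h3 : d / N ≤ 1 := by rw [div_le_one hN0]; exact hdN
  have h4 : 0 ≤ d / N := by positivity
  induction i with
  | zero => simp [aliveDensity]
  | succ i ih =>
    have g0 : 0 ≤ (1 - 1 / N) ^ i := pow_nonneg (by linarith) i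
    have g1 : (1 - 1 / N) ^ i ≤ 1 := pow_le_one₀ (by linarith) (by linarith)
    have f0 := sq_nonneg (aliveDensity d N i)
    have f1 : aliveDensity d N i ^ 2 ≤ 1 := pow_le_one₀ ih.1 ih.2
    have x0 : 0 ≤ d / N * (1 - 1 / N) ^ i * aliveDensity d N i ^ 2 := by positivity
    have x1 : d / N * (1 - 1 / N) ^ i * aliveDensity d N i ^ 2 ≤ 1 :=
      mul_le_one₀ (mul_le_one₀ h3 g0 g1) f0 f1
    rw [aliveDensity]
    exact ⟨mul_nonneg ih.1 (by linarith), mul_le_one₀ ih.2 (by linarith) (by linarith)⟩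

/-- An explicit upper bound for `aliveDensity`. -/
theorem aliveDensity_sq_mul_le {d N : ℝ} (hd : 0 ≤ d) (hdN : d ≤ N) (hN : 1 ≤ N) (i : ℕ) :
    aliveDensity d N i ^ 2 * (1 + 2 * d * (1 - (1 - 1 / N) ^ i)) ≤ 1 := by
  have hN0 : 0 < N := by linarith
  have h1 : 1 / N ≤ 1 := by rw [div_le_one hN0]; exact hN
  have h2 : 0 ≤ 1 / N := by positivity
  have h3 : d / N ≤ 1 := by rw [div_le_one hN0]; exact hdN
  have h4 : 0 ≤ d / N := by positivity
  induction i with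
  | zero => simp [aliveDensity]
  | succ i ih =>
    have hf := aliveDensity_mem hd hdN hN i
    set f := aliveDensity d N i with hfdef
    set g := (1 - 1 / N) ^ i with hg
    have g0 : 0 ≤ g := pow_nonneg (by linarith) i
    have g1 : g ≤ 1 := pow_le_one₀ (by linarith) (by linarith)
    have f0 := sq_nonneg f
    have f1 : f ^ 2 ≤ 1 := pow_le_one₀ hf.1 hf.2
    set x := d / N * g * f ^ 2 with hx
    have x0 : 0 ≤ x := by positivity
    have x1 : x ≤ 1 := mul_le_one₀ (mul_le_one₀ h3 g0 g1) f0 f1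
    rw [aliveDensity, ← hfdef, ← hg, ← hx, pow_succ (1 - 1 / N) i, ← hg]
    -- The conserved quantity `f² (1 + 2d(1 - e^(-t)))` of the differential equation can only
    -- decrease under discretization, because `(1 - x)² (1 + 2x) = 1 - 3x² + 2x³ ≤ 1` on `[0, 1]`.
    have e : (f * (1 - x)) ^ 2 * (1 + 2 * d * (1 - g * (1 - 1 / N))) =
        (1 - x) ^ 2 * (f ^ 2 * (1 + 2 * d * (1 - g)) + 2 * x) := by
      rw [hx]; ring
    rw [e]
    have h5 : f ^ 2 * (1 + 2 * d * (1 - g)) + 2 * x ≤ 1 + 2 * x := by linarith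
    calc _ ≤ (1 - x) ^ 2 * (1 + 2 * x) := mul_le_mul_of_nonneg_left h5 (sq_nonneg _)
      _ ≤ 1 := by nlinarith [mul_nonneg (sq_nonneg x) (sub_nonneg.2 x1), sq_nonneg x]

/-- Linearizes the factor by which `limitSurvival` changes in one step. With `s = k * x + t * y`,
Bernoulli's inequality gives the lower bound; the upper one is `e^(-s) ≤ 1 - s + s²`, which is
trivial for `s > 1`. -/
theorem abs_prod_sub_le {x y : ℝ} (hx0 : 0 ≤ x) (hx1 : x ≤ 1) (hy0 : 0 ≤ y) (hy1 : y ≤ 1)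
    (k t : ℕ) :
    |(1 - x) ^ k * (1 - y) ^ t - (1 - (k * x + t * y))| ≤ (k * x + t * y) ^ 2 := by
  have hs : 0 ≤ k * x + t * y := by positivity
  have lo : 1 - (k * x + t * y) ≤ (1 - x) ^ k * (1 - y) ^ t := by
    have a := one_add_mul_le_pow (a := -x) (by linarith) k
    have b := one_add_mul_le_pow (a := -y) (by linarith) t
    rw [← sub_eq_add_neg] at a b
    have a1 : (1 - x) ^ k ≤ 1 := pow_le_one₀ (by linarith) (by linarith)
    have b1 : (1 - y) ^ t ≤ 1 := pow_le_one₀ (by linarith) (by linarith)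
    nlinarith [mul_nonneg (sub_nonneg.2 a1) (sub_nonneg.2 b1)]
  have hi : (1 - x) ^ k * (1 - y) ^ t ≤ 1 - (k * x + t * y) + (k * x + t * y) ^ 2 := by
    set s := k * x + t * y with hsdef
    have e : (1 - x) ^ k * (1 - y) ^ t ≤ Real.exp (-s) := by
      have a : (1 - x) ^ k ≤ Real.exp (-x) ^ k :=
        pow_le_pow_left₀ (by linarith) (Real.one_sub_le_exp_neg x) k
      have b : (1 - y) ^ t ≤ Real.exp (-y) ^ t :=
        pow_le_pow_left₀ (by linarith) (Real.one_sub_le_exp_neg y) t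
      calc _ ≤ Real.exp (-x) ^ k * Real.exp (-y) ^ t :=
            mul_le_mul a b (pow_nonneg (by linarith) t) (by positivity)
        _ = Real.exp (-s) := by
            rw [← Real.exp_nat_mul, ← Real.exp_nat_mul, ← Real.exp_add]
            congr 1
            rw [hsdef]; ring
    refine e.trans ?_
    by_cases h1 : s ≤ 1
    · have := Real.abs_exp_sub_one_sub_id_le (x := -s) (by rw [abs_neg, abs_of_nonneg hs]; exact h1)
      have := (abs_le.1 this).2
      linarith
    · have : Real.exp (-s) ≤ 1 := Real.exp_le_one_iff.2 (by linarith)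
      nlinarith
  rw [abs_le]
  constructor
  · nlinarith [sq_nonneg (k * x + t * y)]
  · linarith

/-- The rate at which the survival probabilities of sets of size `k` deviate from the solution of
the limiting hierarchy. -/
noncomputable def hierarchyError (C p N : ℝ) (k : ℕ) : ℝ :=
  16 * (k : ℝ) ^ 3 * p + (C * k + (k : ℝ) ^ 2) ^ 2 / N

theorem hierarchyError_mono {C p N : ℝ} (hC : 0 ≤ C) (hp : 0 ≤ p) (hN : 0 ≤ N) {k l : ℕ}
    (h : k ≤ l) : hierarchyError C p N k ≤ hierarchyError C p N l := by
  unfold hierarchyError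
  gcongr

variable {α : Type*} [DecidableEq α]

/-- The limiting value of the normalized survival probability of `S`. -/
noncomputable def limitSurvival (d : ℝ) (𝒯 : Finset (Finset α)) (i : ℕ) (S : Finset α) : ℝ :=
  aliveDensity d 𝒯.card i ^ S.card * ((1 - 1 / (𝒯.card : ℝ)) ^ i) ^ triplesInside 𝒯 S

/-- The deviation of the normalized survival probability of `S` from its limiting value. -/
noncomputable def survivalError (p d : ℝ) (X : Finset α) (𝒯 : Finset (Finset α)) (i : ℕ)
    (S : Finset α) : ℝ :=
  |survival p X 𝒯 i S / p ^ S.card - limitSurvival d 𝒯 i S|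

variable {X : Finset α} {𝒯 : Finset (Finset α)} {D : ℕ} {p d C : ℝ}

theorem limitSurvival_mem (hd : 0 ≤ d) (hdN : d ≤ 𝒯.card) (hN : (1 : ℝ) ≤ 𝒯.card) (i : ℕ)
    (S : Finset α) : 0 ≤ limitSurvival d 𝒯 i S ∧ limitSurvival d 𝒯 i S ≤ 1 := by
  have hf := aliveDensity_mem hd hdN hN i
  have h1 : 1 / (𝒯.card : ℝ) ≤ 1 := by rw [div_le_one (by linarith)]; exact hN
  have h2 : 0 ≤ 1 / (𝒯.card : ℝ) := by positivity
  have g0 : 0 ≤ (1 - 1 / (𝒯.card : ℝ)) ^ i := pow_nonneg (by linarith) i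
  have g1 : (1 - 1 / (𝒯.card : ℝ)) ^ i ≤ 1 := pow_le_one₀ (by linarith) (by linarith)
  unfold limitSurvival
  exact ⟨mul_nonneg (pow_nonneg hf.1 _) (pow_nonneg g0 _),
    mul_le_one₀ (pow_le_one₀ hf.1 hf.2) (pow_nonneg g0 _) (pow_le_one₀ g0 g1)⟩

theorem survivalError_le_one (hp : 0 < p) (hp1 : p ≤ 1) (hd : 0 ≤ d) (hdN : d ≤ 𝒯.card)
    (hN : 𝒯.Nonempty) (i : ℕ) {S : Finset α} (hS : S ⊆ X) : survivalError p d X 𝒯 i S ≤ 1 := by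
  have h1 := limitSurvival_mem hd hdN (by exact_mod_cast hN.card_pos) i S
  have h2 : 0 ≤ survival p X 𝒯 i S / p ^ S.card :=
    div_nonneg (survival_nonneg hp.le hp1 i S) (by positivity)
  have h3 : survival p X 𝒯 i S / p ^ S.card ≤ 1 := by
    rw [div_le_one (by positivity)]
    exact survival_le hp.le hp1 hN i hS
  unfold survivalError
  rw [abs_le]
  constructor <;> linarith [h1.1, h1.2]

theorem limitSurvival_succ (i : ℕ) (S : Finset α) :
    limitSurvival d 𝒯 (i + 1) S = limitSurvival d 𝒯 i S *
      ((1 - d / 𝒯.card * (1 - 1 / (𝒯.card : ℝ)) ^ i * aliveDensity d 𝒯.card i ^ 2) ^ S.card *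
        (1 - 1 / (𝒯.card : ℝ)) ^ triplesInside 𝒯 S) := by
  unfold limitSurvival
  rw [aliveDensity, mul_pow, pow_succ (1 - 1 / (𝒯.card : ℝ)) i, mul_pow (_ ^ i)]
  ring

/-- A pendant triple adds two elements and one inner triple. The resulting factor does not depend on
`T`, which is why the product form solves the limiting hierarchy. -/
theorem IsPendant.limitSurvival_union {S T : Finset α} (h : IsPendant 𝒯 S T) (hT : T.card = 3)
    (i : ℕ) : limitSurvival d 𝒯 i (S ∪ T) = limitSurvival d 𝒯 i S *
      ((1 - 1 / (𝒯.card : ℝ)) ^ i * aliveDensity d 𝒯.card i ^ 2) := by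
  unfold limitSurvival
  rw [h.card_union hT, h.2]
  ring

/-- The recursion for the survival probabilities, split by the way a triple meets `S`. -/
theorem IsLinearTripleSystem.normalized_survival_succ (h : IsLinearTripleSystem X 𝒯 D)
    (hN : 𝒯.Nonempty) (hp : 0 < p) (hp1 : p ≤ 1) (i : ℕ) {S : Finset α} (hS : S ⊆ X)
    (hne : S.Nonempty) :
    ∃ r, 0 ≤ r ∧ r ≤ p * (4 * (S.card : ℝ) ^ 3) ∧
      survival p X 𝒯 (i + 1) S / p ^ S.card = survival p X 𝒯 i S / p ^ S.card -
        (𝒯.card : ℝ)⁻¹ * (triplesInside 𝒯 S * (survival p X 𝒯 i S / p ^ S.card) +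
          p ^ 2 * ∑ T ∈ 𝒯 with IsPendant 𝒯 S T,
            survival p X 𝒯 i (S ∪ T) / p ^ (S ∪ T).card + r) := by
  -- The exceptional triples: each adds at least one new element to `S`, so it contributes at most
  -- `p` after normalization.
  set R : Finset (Finset α) := {T ∈ 𝒯 | ((T ∩ S).Nonempty ∧ ¬ IsPendant 𝒯 S T) ∧ ¬ T ⊆ S} with hR
  have hpS : p ^ S.card ≠ 0 := by positivity
  refine ⟨∑ T ∈ R, survival p X 𝒯 i (S ∪ T) / p ^ S.card, ?_, ?_, ?_⟩
  · exact Finset.sum_nonneg fun T _ => div_nonneg (survival_nonneg hp.le hp1 i _) (by positivity)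
  · have hRc : R.card ≤ 4 * S.card ^ 3 := by
      refine le_trans (Finset.card_le_card fun T hT => ?_) (h.card_not_isPendant_le hne)
      rw [Finset.mem_filter] at hT ⊢
      exact ⟨hT.1, hT.2.1⟩
    have hterm : ∀ T ∈ R, survival p X 𝒯 i (S ∪ T) / p ^ S.card ≤ p := fun T hT => by
      rw [Finset.mem_filter] at hT
      rw [div_le_iff₀ (by positivity), ← pow_succ']
      refine (survival_le hp.le hp1 hN i (Finset.union_subset hS (h.subset T hT.1))).trans ?_
      refine pow_le_pow_of_le_one hp.le hp1 (Finset.card_lt_card ?_)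
      exact Finset.ssubset_iff_subset_ne.2 ⟨Finset.subset_union_left, fun e =>
        hT.2.2 (by rw [e]; exact Finset.subset_union_right)⟩
    calc _ ≤ R.card • p := Finset.sum_le_card_nsmul _ _ _ hterm
      _ = p * R.card := by rw [nsmul_eq_mul, mul_comm]
      _ ≤ _ := mul_le_mul_of_nonneg_left (by exact_mod_cast hRc) hp.le
  · have hsplit : ∑ T ∈ 𝒯 with (T ∩ S).Nonempty, survival p X 𝒯 i (S ∪ T) =
        triplesInside 𝒯 S * survival p X 𝒯 i S +
          ∑ T ∈ 𝒯 with IsPendant 𝒯 S T, survival p X 𝒯 i (S ∪ T) +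
          ∑ T ∈ R, survival p X 𝒯 i (S ∪ T) := by
      have e1 : (triplesInside 𝒯 S : ℝ) * survival p X 𝒯 i S =
          ∑ T ∈ 𝒯 with T ⊆ S, survival p X 𝒯 i (S ∪ T) := by
        rw [Finset.sum_congr rfl fun T hT => by
          rw [Finset.union_eq_left.2 (Finset.mem_filter.1 hT).2]]
        rw [Finset.sum_const, nsmul_eq_mul, triplesInside]
      rw [e1, hR, Finset.sum_filter, Finset.sum_filter, Finset.sum_filter, Finset.sum_filter,
        ← Finset.sum_add_distrib, ← Finset.sum_add_distrib]
      refine Finset.sum_congr rfl fun T hT => ?_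
      by_cases hp : IsPendant 𝒯 S T
      · have h1 : (T ∩ S).Nonempty := Finset.card_pos.1 (by rw [hp.1]; norm_num)
        have h2 : ¬ T ⊆ S := fun hs => by
          have := hp.1
          rw [Finset.inter_eq_left.2 hs, h.card_eq T hT] at this
          omega
        simp [hp, h1, h2]
      · by_cases hs : T ⊆ S
        · have h1 : (T ∩ S).Nonempty := by
            rw [Finset.inter_eq_left.2 hs]
            exact Finset.card_pos.1 (by rw [h.card_eq T hT]; norm_num)
          simp [hp, h1, hs]
        · simp [hp, hs]
    have hpend : p ^ 2 * ∑ T ∈ 𝒯 with IsPendant 𝒯 S T,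
        survival p X 𝒯 i (S ∪ T) / p ^ (S ∪ T).card =
        (∑ T ∈ 𝒯 with IsPendant 𝒯 S T, survival p X 𝒯 i (S ∪ T)) / p ^ S.card := by
      rw [Finset.mul_sum, Finset.sum_div]
      refine Finset.sum_congr rfl fun T hT => ?_
      rw [Finset.mem_filter] at hT
      rw [hT.2.card_union (h.card_eq T hT.1)]
      field_simp
      ring
    rw [survival_succ hN, hsplit, hpend, ← Finset.sum_div]
    field_simp

/-- The elementary estimate behind one step of the comparison with the limiting hierarchy. -/
theorem abs_step_sub_le {a φ q y k t d C p D m δ r s w : ℝ} (hφ0 : 0 ≤ φ) (hφ1 : φ ≤ 1)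
    (hq0 : 0 ≤ q) (hq1 : q ≤ 1) (hy0 : 0 < y) (hk0 : 0 ≤ k) (ht0 : 0 ≤ t) (htk : t ≤ k ^ 2)
    (hty : t * y ≤ 1) (hd0 : 0 ≤ d) (hdC : d ≤ C) (hdD : d = D * p ^ 2) (hp0 : 0 < p) (hp1 : p ≤ 1)
    (hm1 : m ≤ k * D) (hm2 : k * D ≤ m + 12 * k ^ 3) (hδ0 : 0 ≤ δ)
    (hs : |s - m * (φ * q)| ≤ m * δ) (hr0 : 0 ≤ r) (hr : r ≤ p * (4 * k ^ 3))
    (hw : |w - (1 - (k * (d * y * q) + t * y))| ≤ (k * (d * y * q) + t * y) ^ 2) :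
    |a - y * (t * a + p ^ 2 * s + r) - φ * w| ≤
      |a - φ| + y * (d * k * δ + (16 * k ^ 3 * p + (C * k + k ^ 2) ^ 2 * y)) := by
  have hp2 : 0 ≤ p ^ 2 := sq_nonneg p
  have hpp : p ^ 2 ≤ p := by
    rw [sq]; exact mul_le_of_le_one_left hp0.le hp1
  have hk3 : 0 ≤ k ^ 3 := by positivity
  have hty0 : 0 ≤ t * y := by positivity
  have e1 : |p ^ 2 * (s - m * (φ * q))| ≤ d * k * δ := by
    rw [abs_mul, abs_of_nonneg hp2]
    calc _ ≤ p ^ 2 * (k * D * δ) :=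
          mul_le_mul_of_nonneg_left (hs.trans (mul_le_mul_of_nonneg_right hm1 hδ0)) hp2
      _ = d * k * δ := by rw [hdD]; ring
  have hφq0 : 0 ≤ φ * q := mul_nonneg hφ0 hq0
  have hφq1 : φ * q ≤ 1 := mul_le_one₀ hφ1 hq0 hq1
  have e2 : |(p ^ 2 * m - d * k) * (φ * q)| ≤ 12 * k ^ 3 * p := by
    rw [abs_mul, abs_of_nonneg hφq0]
    have : |p ^ 2 * m - d * k| ≤ 12 * k ^ 3 * p := by
      have h1 := mul_le_mul_of_nonneg_left hm2 hp2
      have h2 := mul_le_mul_of_nonneg_left hm1 hp2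
      have h3 : p ^ 2 * (12 * k ^ 3) ≤ p * (12 * k ^ 3) :=
        mul_le_mul_of_nonneg_right hpp (by positivity)
      have h4 : 0 ≤ 12 * k ^ 3 * p := by positivity
      rw [abs_le, hdD]
      constructor <;> linarith
    calc _ ≤ 12 * k ^ 3 * p * 1 := mul_le_mul this hφq1 hφq0 (by positivity)
      _ = _ := mul_one _
  have e3 : |φ * (w - (1 - (k * (d * y * q) + t * y)))| ≤ y * ((C * k + k ^ 2) ^ 2 * y) := by
    rw [abs_mul, abs_of_nonneg hφ0]
    have h0 : 0 ≤ k * (d * y * q) + t * y := by positivity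
    have hxd : d * y * q ≤ C * y :=
      (mul_le_of_le_one_right (by positivity) hq1).trans (mul_le_mul_of_nonneg_right hdC hy0.le)
    have h1 : k * (d * y * q) + t * y ≤ (C * k + k ^ 2) * y := by
      have h2 := mul_le_mul_of_nonneg_left hxd hk0
      have h3 := mul_le_mul_of_nonneg_right htk hy0.le
      linarith
    calc _ ≤ 1 * (k * (d * y * q) + t * y) ^ 2 := mul_le_mul hφ1 hw (abs_nonneg _) zero_le_one
      _ ≤ 1 * ((C * k + k ^ 2) * y) ^ 2 := by gcongr
      _ = _ := by ring
  have e4 : |(1 - t * y) * (a - φ)| ≤ |a - φ| := by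
    rw [abs_mul, abs_of_nonneg (by linarith : 0 ≤ 1 - t * y)]
    exact mul_le_of_le_one_left (abs_nonneg _) (by linarith)
  -- Four sources of new error: deviations at the pendant extensions, the shortfall of the pendant
  -- count (`12 k³ p`), the exceptional triples (`4 k³ p`, which makes `16`), and the second-order
  -- term of the limit. The old error is only contracted.
  have key : a - y * (t * a + p ^ 2 * s + r) - φ * w = (1 - t * y) * (a - φ) -
      (y * (p ^ 2 * (s - m * (φ * q))) + y * ((p ^ 2 * m - d * k) * (φ * q)) + y * r +
      φ * (w - (1 - (k * (d * y * q) + t * y)))) := by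
    ring
  have b1 : |y * (p ^ 2 * (s - m * (φ * q)))| ≤ y * (d * k * δ) := by
    rw [abs_mul, abs_of_pos hy0]; exact mul_le_mul_of_nonneg_left e1 hy0.le
  have b2 : |y * ((p ^ 2 * m - d * k) * (φ * q))| ≤ y * (12 * k ^ 3 * p) := by
    rw [abs_mul, abs_of_pos hy0]; exact mul_le_mul_of_nonneg_left e2 hy0.le
  have b3 : |y * r| ≤ y * (p * (4 * k ^ 3)) := by
    rw [abs_mul, abs_of_pos hy0, abs_of_nonneg hr0]; exact mul_le_mul_of_nonneg_left hr hy0.le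
  rw [key]
  refine (abs_sub _ _).trans ?_
  refine (add_le_add e4 ((abs_add_le _ _).trans (add_le_add ((abs_add_le _ _).trans
    (add_le_add ((abs_add_le _ _).trans (add_le_add b1 b2)) b3)) e3))).trans (le_of_eq ?_)
  ring

/-- One step of the comparison of the survival probabilities with the limiting hierarchy. -/
theorem IsLinearTripleSystem.survivalError_succ (h : IsLinearTripleSystem X 𝒯 D)
    (hN : 𝒯.Nonempty) (hp : 0 < p) (hp1 : p ≤ 1) (hdD : d = D * p ^ 2) (hdC : d ≤ C)
    (hCN : C ≤ 𝒯.card) (i : ℕ) {S : Finset α} (hS : S ⊆ X) (hne : S.Nonempty) {δ : ℝ}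
    (hδ : ∀ T ∈ 𝒯, IsPendant 𝒯 S T → survivalError p d X 𝒯 i (S ∪ T) ≤ δ) (hδ0 : 0 ≤ δ) :
    survivalError p d X 𝒯 (i + 1) S ≤ survivalError p d X 𝒯 i S +
      (𝒯.card : ℝ)⁻¹ * (d * S.card * δ + hierarchyError C p 𝒯.card S.card) := by
  have hN1 : (1 : ℝ) ≤ 𝒯.card := by exact_mod_cast hN.card_pos
  have hN0 : (0 : ℝ) < 𝒯.card := by linarith
  have hd : 0 ≤ d := by rw [hdD]; positivity
  have hdN : d ≤ 𝒯.card := hdC.trans hCN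
  obtain ⟨r, hr0, hr, hrec⟩ := h.normalized_survival_succ hN hp hp1 i hS hne
  have hφ := limitSurvival_mem hd hdN hN1 i S
  have hf := aliveDensity_mem hd hdN hN1 i
  have hy0 : (0 : ℝ) < (𝒯.card : ℝ)⁻¹ := inv_pos.2 hN0
  have hy1 : (𝒯.card : ℝ)⁻¹ ≤ 1 := inv_le_one_of_one_le₀ hN1
  have hg0 : 0 ≤ (1 - 1 / (𝒯.card : ℝ)) ^ i := pow_nonneg (by rw [one_div]; linarith) i
  have hg1 : (1 - 1 / (𝒯.card : ℝ)) ^ i ≤ 1 :=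
    pow_le_one₀ (by rw [one_div]; linarith) (by rw [one_div]; linarith)
  have hq0 : 0 ≤ (1 - 1 / (𝒯.card : ℝ)) ^ i * aliveDensity d 𝒯.card i ^ 2 :=
    mul_nonneg hg0 (sq_nonneg _)
  have hq1 : (1 - 1 / (𝒯.card : ℝ)) ^ i * aliveDensity d 𝒯.card i ^ 2 ≤ 1 :=
    mul_le_one₀ hg1 (sq_nonneg _) (pow_le_one₀ hf.1 hf.2)
  have hdy : d * (𝒯.card : ℝ)⁻¹ ≤ 1 := by rw [← div_eq_mul_inv, div_le_one hN0]; exact hdN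
  have hPδ : |∑ T ∈ 𝒯 with IsPendant 𝒯 S T, survival p X 𝒯 i (S ∪ T) / p ^ (S ∪ T).card -
      ({T ∈ 𝒯 | IsPendant 𝒯 S T} : Finset (Finset α)).card * (limitSurvival d 𝒯 i S *
        ((1 - 1 / (𝒯.card : ℝ)) ^ i * aliveDensity d 𝒯.card i ^ 2))| ≤
      ({T ∈ 𝒯 | IsPendant 𝒯 S T} : Finset (Finset α)).card * δ := by
    rw [← nsmul_eq_mul, ← Finset.sum_const, ← Finset.sum_sub_distrib, ← nsmul_eq_mul]
    refine (Finset.abs_sum_le_sum_abs _ _).trans (Finset.sum_le_card_nsmul _ _ _ fun T hT => ?_)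
    rw [Finset.mem_filter] at hT
    have := hδ T hT.1 hT.2
    rwa [survivalError, hT.2.limitSurvival_union (h.card_eq T hT.1)] at this
  have hprod := abs_prod_sub_le (mul_nonneg (mul_nonneg hd hy0.le) hq0)
    (mul_le_one₀ hdy hq0 hq1) hy0.le hy1 S.card (triplesInside 𝒯 S)
  have main := abs_step_sub_le (a := survival p X 𝒯 i S / p ^ S.card) hφ.1 hφ.2 hq0 hq1 hy0
    (Nat.cast_nonneg S.card) (Nat.cast_nonneg (triplesInside 𝒯 S))
    (by exact_mod_cast h.triplesInside_le S)
    (by rw [← div_eq_mul_inv, div_le_one hN0]; exact_mod_cast Finset.card_filter_le _ _)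
    hd hdC hdD hp hp1 (by exact_mod_cast h.card_isPendant_le hS)
    (by exact_mod_cast h.le_card_isPendant hS hne) hδ0 hPδ hr0 hr hprod
  unfold survivalError
  rw [hrec, limitSurvival_succ, hierarchyError, div_eq_mul_inv _ (𝒯.card : ℝ)]
  convert main using 6
  · ring
  · rw [one_div]
  · rw [div_eq_mul_inv]

end SurvivalLimit

/-! ### Propagating the error estimate through time blocks. -/

section SurvivalBlocks

variable {α : Type*} [DecidableEq α] {X : Finset α} {𝒯 : Finset (Finset α)} {D : ℕ} {p d C : ℝ}

theorem pow_succ_add_le {r h : ℝ} (hr : 0 ≤ r) (hh : 0 ≤ h) (j : ℕ) :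
    r ^ (j + 1) + (j + 1) * r ^ j * h ≤ (r + h) ^ (j + 1) := by
  induction j with
  | zero => simp
  | succ j ih =>
    rw [pow_succ (r + h)]
    have := mul_le_mul_of_nonneg_right ih (add_nonneg hr hh)
    refine le_trans ?_ this
    have h2 : 0 ≤ (j + 1) * r ^ j * h * h := by positivity
    push_cast
    linarith [show (r ^ (j + 1) + (j + 1) * r ^ j * h) * (r + h) =
      r ^ (j + 1 + 1) + ((j : ℝ) + 1 + 1) * r ^ (j + 1) * h + (j + 1) * r ^ j * h * h by ring]

/-- A geometric supersolution of the error recursion. -/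
theorem pow_add_step_le {r y C : ℝ} (hr1 : 1 ≤ r) (hr3 : r ≤ 3) (hy : 0 ≤ y) (hC : 0 ≤ C) {k : ℕ}
    (hk : 0 < k) :
    r ^ k + y * (C * k * r ^ (k + 2) + 1) ≤ (r + (27 * C + 1) * y) ^ k := by
  obtain ⟨j, rfl⟩ := Nat.exists_eq_add_of_lt hk
  rw [zero_add]
  have hr0 : 0 ≤ r := by linarith
  refine le_trans ?_ (pow_succ_add_le hr0 (by positivity) j)
  have h1 : 1 ≤ r ^ j := one_le_pow₀ hr1
  have h3 : r ^ 3 ≤ 27 := by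
    calc r ^ 3 ≤ 3 ^ 3 := pow_le_pow_left₀ hr0 hr3 3
      _ = 27 := by norm_num
  -- Origin of `27`: for `k = j + 1`, the power `r ^ (k + 2)` exceeds the `r ^ (k - 1)` of the
  -- derivative of `r ^ k` by `r ^ 3 ≤ 27`.
  have e : r ^ (j + 1 + 2) = r ^ j * r ^ 3 := by ring
  have h4 : C * ((j + 1 : ℕ) : ℝ) * r ^ (j + 1 + 2) ≤ C * ((j + 1 : ℕ) : ℝ) * (r ^ j * 27) := by
    rw [e]; gcongr
  have h5 : 1 ≤ ((j : ℝ) + 1) * r ^ j := by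
    have : (0 : ℝ) ≤ j := by positivity
    nlinarith
  have h6 : y * (C * ((j + 1 : ℕ) : ℝ) * r ^ (j + 1 + 2) + 1) ≤
      y * (C * ((j + 1 : ℕ) : ℝ) * (r ^ j * 27) + (j + 1) * r ^ j) := by gcongr
  push_cast at h6 ⊢
  linarith

/-- Propagation of smallness of the error over a time block of constant length. -/
theorem IsLinearTripleSystem.survivalError_block (h : IsLinearTripleSystem X 𝒯 D)
    (hN : 𝒯.Nonempty) (hp : 0 < p) (hp1 : p ≤ 1) (hdD : d = D * p ^ 2) (hdC : d ≤ C)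
    (hCN : C ≤ 𝒯.card) {K i₀ : ℕ} (hE : hierarchyError C p 𝒯.card K ≤ (1 / 2) ^ K)
    (h0 : ∀ S ⊆ X, S.Nonempty → S.card < K → survivalError p d X 𝒯 i₀ S ≤ (1 / 2) ^ K)
    (l : ℕ) (hl : (27 * C + 1) * l ≤ 𝒯.card) {S : Finset α} (hS : S ⊆ X) (hne : S.Nonempty) :
    survivalError p d X 𝒯 (i₀ + l) S ≤
      (1 / 2) ^ K * (2 + (27 * C + 1) * l * (𝒯.card : ℝ)⁻¹) ^ S.card := by
  have hN0 : (0 : ℝ) < 𝒯.card := by exact_mod_cast hN.card_pos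
  have hy : (0 : ℝ) ≤ (𝒯.card : ℝ)⁻¹ := by positivity
  have hd : 0 ≤ d := by rw [hdD]; positivity
  have hC : 0 ≤ C := hd.trans hdC
  -- Truncation of the hierarchy: with base at least two, the claimed bound exceeds the trivial
  -- bound one for all sets of size at least `K`.
  have hlarge : ∀ (r : ℝ) (S : Finset α), 2 ≤ r → K ≤ S.card →
      (1 : ℝ) ≤ (1 / 2) ^ K * r ^ S.card := fun r S hr hK => by
    calc (1 : ℝ) = (1 / 2) ^ K * 2 ^ K := by rw [← mul_pow]; norm_num
      _ ≤ (1 / 2) ^ K * 2 ^ S.card := by gcongr; norm_num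
      _ ≤ _ := by gcongr
  have hρ : (0 : ℝ) ≤ (1 / 2) ^ K := by positivity
  induction l generalizing S with
  | zero =>
    rcases lt_or_ge S.card K with hK | hK
    · refine (h0 S hS hne hK).trans ?_
      exact le_mul_of_one_le_right hρ (one_le_pow₀ (by simp))
    · exact (survivalError_le_one hp hp1 hd (hdC.trans hCN) hN _ hS).trans
        (hlarge _ S (by simp) hK)
  | succ l ih =>
    have hl' : (27 * C + 1) * (l : ℝ) ≤ 𝒯.card := by
      refine le_trans ?_ hl
      gcongr
      exact Nat.le_succ l
    have hr2 : 2 ≤ 2 + (27 * C + 1) * (l : ℝ) * (𝒯.card : ℝ)⁻¹ :=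
      le_add_of_nonneg_right (by positivity)
    have hr3 : 2 + (27 * C + 1) * (l : ℝ) * (𝒯.card : ℝ)⁻¹ ≤ 3 := by
      have : (27 * C + 1) * (l : ℝ) * (𝒯.card : ℝ)⁻¹ ≤ 1 := by
        rw [← div_eq_mul_inv, div_le_one hN0]; exact hl'
      linarith
    have hr' : 2 + (27 * C + 1) * ((l + 1 : ℕ) : ℝ) * (𝒯.card : ℝ)⁻¹ =
        2 + (27 * C + 1) * (l : ℝ) * (𝒯.card : ℝ)⁻¹ + (27 * C + 1) * (𝒯.card : ℝ)⁻¹ := by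
      push_cast; ring
    set r := 2 + (27 * C + 1) * (l : ℝ) * (𝒯.card : ℝ)⁻¹ with hr
    rcases lt_or_ge S.card K with hK | hK
    · have hE' : hierarchyError C p 𝒯.card S.card ≤ (1 / 2) ^ K :=
        (hierarchyError_mono hC hp.le hN0.le hK.le).trans hE
      have hstep := h.survivalError_succ (δ := (1 / 2) ^ K * r ^ (S.card + 2)) hN hp hp1 hdD hdC hCN
        (i₀ + l) hS hne (fun T hT hTp => by
          rw [← hTp.card_union (h.card_eq T hT)]
          exact ih hl' (Finset.union_subset hS (h.subset T hT))
            (hne.mono Finset.subset_union_left)) (by positivity)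
      rw [← add_assoc, hr']
      refine hstep.trans ?_
      have hk := pow_add_step_le (by linarith : 1 ≤ r) hr3 hy hC hne.card_pos
      refine le_trans ?_ (mul_le_mul_of_nonneg_left hk hρ)
      have h1 := ih hl' hS hne
      have h2 : d * S.card * ((1 / 2) ^ K * r ^ (S.card + 2)) ≤
          C * S.card * ((1 / 2) ^ K * r ^ (S.card + 2)) := by gcongr
      have h3 := mul_le_mul_of_nonneg_left (add_le_add h2 hE') hy
      linarith
    · exact (survivalError_le_one hp hp1 hd (hdC.trans hCN) hN _ hS).trans
        (hlarge _ S (by rw [hr']; refine hr2.trans (le_add_of_nonneg_right (by positivity))) hK)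

/-- The survival probabilities follow the limiting hierarchy over any bounded number of blocks. -/
theorem IsLinearTripleSystem.survivalError_le (h : IsLinearTripleSystem X 𝒯 D)
    (hN : 𝒯.Nonempty) (hp : 0 < p) (hp1 : p ≤ 1) (hdD : d = D * p ^ 2) (hdC : d ≤ C)
    (hCN : C ≤ 𝒯.card) (j K : ℕ)
    (hE : hierarchyError C p 𝒯.card (3 ^ j * K) ≤ (1 / 2) ^ (3 ^ j * K)) (i : ℕ)
    (hi : i ≤ j * ⌊(𝒯.card : ℝ) / (27 * C + 1)⌋₊) {S : Finset α} (hS : S ⊆ X) (hne : S.Nonempty)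
    (hK : S.card < K) : survivalError p d X 𝒯 i S ≤ (1 / 2) ^ K := by
  have hN0 : (0 : ℝ) < 𝒯.card := by exact_mod_cast hN.card_pos
  have hd : 0 ≤ d := by rw [hdD]; positivity
  have hC : 0 ≤ C := hd.trans hdC
  set M := ⌊(𝒯.card : ℝ) / (27 * C + 1)⌋₊ with hM
  induction j generalizing K i S with
  | zero =>
    -- At time zero both the normalized survival probability and its limit equal one.
    obtain rfl : i = 0 := by simpa using hi
    have : survivalError p d X 𝒯 0 S = 0 := by
      rw [survivalError, survival_zero hS, div_self (by positivity), limitSurvival, aliveDensity]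
      simp
    rw [this]; positivity
  | succ j ih =>
    have hpow : 3 ^ (j + 1) * K = 3 ^ j * (3 * K) := by ring
    rw [hpow] at hE
    have hK3 : K ≤ 3 * K := by omega
    by_cases hij : i ≤ j * M
    · exact (ih (3 * K) hE i hS hne (by omega) hij).trans
        (pow_le_pow_of_le_one (by norm_num) (by norm_num) hK3)
    · obtain ⟨l, rfl⟩ := Nat.exists_eq_add_of_le (not_le.1 hij).le
      have hlM : l ≤ M := by rw [Nat.succ_mul] at hi; omega
      have hl : (27 * C + 1) * (l : ℝ) ≤ 𝒯.card := by
        have h1 : (l : ℝ) ≤ (𝒯.card : ℝ) / (27 * C + 1) :=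
          (Nat.cast_le.2 hlM).trans (Nat.floor_le (by positivity))
        rw [le_div_iff₀ (by positivity)] at h1
        linarith
      have hle : 3 * K ≤ 3 ^ j * (3 * K) := Nat.le_mul_of_pos_left _ (by positivity)
      have hE' : hierarchyError C p 𝒯.card (3 * K) ≤ (1 / 2) ^ (3 * K) :=
        ((hierarchyError_mono hC hp.le hN0.le hle).trans hE).trans
          (pow_le_pow_of_le_one (by norm_num) (by norm_num) hle)
      have := h.survivalError_block hN hp hp1 hdD hdC hCN hE'
        (fun S hS hne hK => ih (3 * K) hE (j * M) hS hne hK le_rfl) l hl hS hne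
      refine this.trans ?_
      have hr3 : 2 + (27 * C + 1) * (l : ℝ) * (𝒯.card : ℝ)⁻¹ ≤ 3 := by
        have : (27 * C + 1) * (l : ℝ) * (𝒯.card : ℝ)⁻¹ ≤ 1 := by
          rw [← div_eq_mul_inv, div_le_one hN0]; exact hl
        linarith
      -- The base, at most `3`, is relaxed to `4` so that `8^(-K) * 4^K = 2^(-K)`; this is why each
      -- block divides the size cutoff by three.
      calc (1 / 2 : ℝ) ^ (3 * K) * (2 + (27 * C + 1) * (l : ℝ) * (𝒯.card : ℝ)⁻¹) ^ S.card
          ≤ (1 / 2 : ℝ) ^ (3 * K) * 4 ^ S.card := by gcongr; linarith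
        _ ≤ (1 / 2 : ℝ) ^ (3 * K) * 4 ^ K := by gcongr; norm_num
        _ = (1 / 2) ^ K := by
          rw [pow_mul, ← mul_pow]
          norm_num

/-- The greedy removal process leaves at most about a proportion `(1 + 2d)^(-1/2)` of the elements
of a random set, so any function which counts disjoint triples is large in expectation. -/
theorem IsLinearTripleSystem.le_expectation (h : IsLinearTripleSystem X 𝒯 D)
    (hN : 𝒯.Nonempty) (hp : 0 < p) (hp1 : p ≤ 1) (hdD : d = D * p ^ 2) (hdC : d ≤ C)
    (hCN : C ≤ 𝒯.card) (h2N : 2 * (27 * C + 1) ≤ 𝒯.card) (j K : ℕ) (hK : 1 < K)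
    (hE : hierarchyError C p 𝒯.card (3 ^ j * K) ≤ (1 / 2) ^ (3 ^ j * K))
    {ν : Finset α → ℝ} (hν : ∀ A, 0 ≤ ν A)
    (hνT : ∀ A, ∀ T ∈ 𝒯, T ⊆ A → ν (A \ T) + 1 ≤ ν A) :
    X.card * p * (1 - (√(1 + 2 * d))⁻¹ - C * Real.exp (-(j / (2 * (27 * C + 1)))) - (1 / 2) ^ K) ≤
      3 * bernoulliSum p X ν := by
  have hN1 : (1 : ℝ) ≤ 𝒯.card := by exact_mod_cast hN.card_pos
  have hN0 : (0 : ℝ) < 𝒯.card := by linarith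
  have hd : 0 ≤ d := by rw [hdD]; positivity
  have hC : 0 ≤ C := hd.trans hdC
  have hdN : d ≤ 𝒯.card := hdC.trans hCN
  set M := ⌊(𝒯.card : ℝ) / (27 * C + 1)⌋₊ with hM
  set i := j * M with hi
  set g := (1 - 1 / (𝒯.card : ℝ)) ^ i with hg
  have hy1 : 1 / (𝒯.card : ℝ) ≤ 1 := by rw [div_le_one hN0]; exact hN1
  have hy0 : 0 ≤ 1 / (𝒯.card : ℝ) := by positivity
  have hg0 : 0 ≤ g := pow_nonneg (by linarith) i
  have hg1 : g ≤ 1 := pow_le_one₀ (by linarith) (by linarith)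
  have hgexp : g ≤ Real.exp (-(j / (2 * (27 * C + 1)))) := by
    -- Rounding down loses at most half of a number that is at least two, so `j` blocks last for
    -- time at least `j / (2 * (27 * C + 1))`.
    have hMlo : (𝒯.card : ℝ) / (2 * (27 * C + 1)) ≤ M := by
      have h1 := Nat.lt_floor_add_one ((𝒯.card : ℝ) / (27 * C + 1))
      rw [← hM] at h1
      have h2 : 2 ≤ (𝒯.card : ℝ) / (27 * C + 1) := by
        rw [le_div_iff₀ (by positivity)]; exact h2N
      have h3 : (𝒯.card : ℝ) / (2 * (27 * C + 1)) = (𝒯.card : ℝ) / (27 * C + 1) / 2 := by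
        rw [mul_comm, div_div]
      linarith
    calc g ≤ Real.exp (-(1 / (𝒯.card : ℝ))) ^ i :=
          pow_le_pow_left₀ (by linarith) (Real.one_sub_le_exp_neg _) i
      _ = Real.exp (-(j * (M / 𝒯.card))) := by
          rw [← Real.exp_nat_mul, hi]
          congr 1
          push_cast
          ring
      _ ≤ _ := by
          rw [Real.exp_le_exp, neg_le_neg_iff, div_eq_mul_inv]
          gcongr
          rw [le_div_iff₀ hN0, ← div_eq_inv_mul]
          exact hMlo
  have hf := aliveDensity_mem hd hdN hN1 i
  have hfle : aliveDensity d 𝒯.card i ≤ (√(1 + 2 * d))⁻¹ + d * g := by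
    have hsq := aliveDensity_sq_mul_le hd hdN hN1 i
    rw [← hg] at hsq
    have hb : 1 ≤ 1 + 2 * d * (1 - g) :=
      le_add_of_nonneg_right (mul_nonneg (by positivity) (by linarith))
    have hz1 : 1 ≤ √(1 + 2 * d * (1 - g)) := Real.one_le_sqrt.2 hb
    have hw1 : 1 ≤ √(1 + 2 * d) := Real.one_le_sqrt.2 (by linarith)
    have hz2 : √(1 + 2 * d * (1 - g)) ^ 2 = 1 + 2 * d * (1 - g) := Real.sq_sqrt (by linarith)
    have hw2 : √(1 + 2 * d) ^ 2 = 1 + 2 * d := Real.sq_sqrt (by linarith)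
    set z := √(1 + 2 * d * (1 - g))
    set w := √(1 + 2 * d)
    have h1 : aliveDensity d 𝒯.card i ≤ z⁻¹ := by
      rw [← one_div, le_div_iff₀ (by linarith)]
      refine (pow_le_one_iff_of_nonneg (mul_nonneg hf.1 (by linarith)) two_ne_zero).1 ?_
      rw [mul_pow, hz2]
      exact hsq
    have h2 : z⁻¹ ≤ w⁻¹ + d * g := by
      have hdg : 0 ≤ d * g := mul_nonneg hd hg0
      -- Here `w² - z² = 2 * d * g` while `w + z ≥ 2`.
      have h3 : w ≤ z + d * g := by
        by_contra! hlt
        nlinarith [mul_nonneg hdg (by linarith : 0 ≤ w + z - 2)]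
      have h4 : d * g ≤ d * g * (z * w) :=
        le_mul_of_one_le_right hdg (one_le_mul_of_one_le_of_one_le hz1 hw1)
      have h5 : w⁻¹ + d * g - z⁻¹ = (z + d * g * (z * w) - w) / (z * w) := by
        field_simp
      have h6 : 0 ≤ (z + d * g * (z * w) - w) / (z * w) :=
        div_nonneg (by linarith) (by positivity)
      linarith
    exact h1.trans h2
  have hsurv : ∀ x ∈ X, survival p X 𝒯 i {x} ≤
      p * ((√(1 + 2 * d))⁻¹ + C * Real.exp (-(j / (2 * (27 * C + 1)))) + (1 / 2) ^ K) := by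
    intro x hx
    have herr := h.survivalError_le hN hp hp1 hdD hdC hCN j K hE i le_rfl
      (Finset.singleton_subset_iff.2 hx) (Finset.singleton_nonempty x) (by simpa using hK)
    have htri : triplesInside 𝒯 {x} = 0 := by
      rw [triplesInside, Finset.card_eq_zero, Finset.filter_eq_empty_iff]
      intro T hT hs
      have := Finset.card_le_card hs
      rw [h.card_eq T hT] at this
      simp at this
    rw [survivalError, limitSurvival, htri, Finset.card_singleton, pow_one, pow_one, pow_zero,
      mul_one] at herr
    have h1 := (abs_le.1 herr).2
    have h2 : d * g ≤ C * Real.exp (-(j / (2 * (27 * C + 1)))) :=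
      mul_le_mul hdC hgexp hg0 hC
    have h3 : survival p X 𝒯 i {x} / p ≤
        (√(1 + 2 * d))⁻¹ + C * Real.exp (-(j / (2 * (27 * C + 1)))) + (1 / 2) ^ K := by linarith
    rw [div_le_iff₀ hp] at h3
    linarith
  have hmain := expected_removed_le hp.le hp1 hN h.card_eq hν hνT (X := X) i
  have hsum := Finset.sum_le_card_nsmul _ _ _ hsurv
  rw [nsmul_eq_mul] at hsum
  linarith

end SurvivalBlocks

/-! ### Triangles of a complete graph as a linear triple system; the binomial random graph. -/

section GraphTriangles

variable {V : Type*} [DecidableEq V]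

/-- The pairs of distinct elements of `s`. -/
def pairsOf (s : Finset V) : Finset (Sym2 V) := s.offDiag.image Sym2.mk.uncurry

theorem mk_mem_pairsOf {s : Finset V} {x y : V} : s(x, y) ∈ pairsOf s ↔ x ∈ s ∧ y ∈ s ∧ x ≠ y := by
  simp only [pairsOf, Finset.mem_image, Finset.mem_offDiag, Prod.exists, Function.uncurry_apply_pair,
    Sym2.eq_iff]
  constructor
  · rintro ⟨a, b, ⟨ha, hb, hab⟩, ⟨rfl, rfl⟩ | ⟨rfl, rfl⟩⟩
    · exact ⟨ha, hb, hab⟩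
    · exact ⟨hb, ha, hab.symm⟩
  · rintro ⟨hx, hy, hxy⟩
    exact ⟨x, y, ⟨hx, hy, hxy⟩, Or.inl ⟨rfl, rfl⟩⟩

theorem card_pairsOf (s : Finset V) : (pairsOf s).card = s.card.choose 2 :=
  Sym2.card_image_offDiag s

theorem pairsOf_mono {s t : Finset V} (h : s ⊆ t) : pairsOf s ⊆ pairsOf t :=
  Finset.image_subset_image (Finset.offDiag_mono h)

/-- Two distinct edges span at least three vertices, hence determine the triangle containing them.
This is the linearity of the triple system. -/
theorem eq_of_mem_pairsOf {s t : Finset V} (hs : s.card = 3) (ht : t.card = 3) {e f : Sym2 V}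
    (hef : e ≠ f) (hes : e ∈ pairsOf s) (hfs : f ∈ pairsOf s) (het : e ∈ pairsOf t)
    (hft : f ∈ pairsOf t) : s = t := by
  induction e with | _ a b =>
  induction f with | _ c d =>
  rw [mk_mem_pairsOf] at hes hfs het hft
  have hsub : ({a, b, c, d} : Finset V) ⊆ s ∩ t := by
    intro x hx
    simp only [Finset.mem_insert, Finset.mem_singleton] at hx
    rw [Finset.mem_inter]
    rcases hx with rfl | rfl | rfl | rfl
    · exact ⟨hes.1, het.1⟩
    · exact ⟨hes.2.1, het.2.1⟩
    · exact ⟨hfs.1, hft.1⟩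
    · exact ⟨hfs.2.1, hft.2.1⟩
  have h3 : 3 ≤ ({a, b, c, d} : Finset V).card := by
    have hab := hes.2.2
    have hcd := hfs.2.2
    by_cases hc : c ∈ ({a, b} : Finset V)
    · have hd : d ∉ ({a, b} : Finset V) := by
        intro hd
        simp only [Finset.mem_insert, Finset.mem_singleton] at hc hd
        refine hef ?_
        rw [Sym2.eq_iff]
        rcases hc with rfl | rfl <;> rcases hd with rfl | rfl <;> simp_all
      calc 3 = (insert d ({a, b} : Finset V)).card := by
            rw [Finset.card_insert_of_notMem hd, Finset.card_pair hab]
        _ ≤ _ := Finset.card_le_card fun x hx => by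
            simp only [Finset.mem_insert, Finset.mem_singleton] at hx ⊢
            tauto
    · calc 3 = (insert c ({a, b} : Finset V)).card := by
            rw [Finset.card_insert_of_notMem hc, Finset.card_pair hab]
        _ ≤ _ := Finset.card_le_card fun x hx => by
            simp only [Finset.mem_insert, Finset.mem_singleton] at hx ⊢
            tauto
  have hst := h3.trans (Finset.card_le_card hsub)
  have e1 : s ∩ t = s := Finset.eq_of_subset_of_card_le Finset.inter_subset_left (hs ▸ hst)
  have e2 : s ∩ t = t := Finset.eq_of_subset_of_card_le Finset.inter_subset_right (ht ▸ hst)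
  exact e1.symm.trans e2

theorem pairsOf_injOn : Set.InjOn (pairsOf (V := V)) {s | s.card = 3} := by
  intro s hs t ht h
  have h2 : 1 < (pairsOf s).card := by
    rw [card_pairsOf, show s.card = 3 from hs]; decide
  obtain ⟨e, he, f, hf, hef⟩ := Finset.one_lt_card.1 h2
  exact eq_of_mem_pairsOf hs ht hef he hf (h ▸ he) (h ▸ hf)

variable (V) in
/-- The edge sets of the triangles on `V`. -/
def triangleTriples [Fintype V] : Finset (Finset (Sym2 V)) :=
  ((Finset.univ : Finset V).powersetCard 3).image pairsOf

theorem mem_triangleTriples [Fintype V] {T : Finset (Sym2 V)} :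
    T ∈ triangleTriples V ↔ ∃ t : Finset V, t.card = 3 ∧ pairsOf t = T := by
  simp [triangleTriples, Finset.mem_powersetCard]

theorem card_triangleTriples [Fintype V] :
    (triangleTriples V).card = (Fintype.card V).choose 3 := by
  rw [triangleTriples, Finset.card_image_of_injOn, Finset.card_powersetCard, Finset.card_univ]
  exact pairsOf_injOn.mono fun s hs => (Finset.mem_powersetCard.1 hs).2

theorem card_triangleTriples_through [Fintype V] {e : Sym2 V}
    (he : e ∈ pairsOf (Finset.univ : Finset V)) :
    ({T ∈ triangleTriples V | e ∈ T} : Finset (Finset (Sym2 V))).card = Fintype.card V - 2 := by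
  induction e with | _ a b =>
  rw [mk_mem_pairsOf] at he
  have hab := he.2.2
  have hc : (({a, b} : Finset V)ᶜ).card = Fintype.card V - 2 := by
    rw [Finset.card_compl, Finset.card_pair hab]
  have hcard : ∀ c ∈ ({a, b} : Finset V)ᶜ, (insert c ({a, b} : Finset V)).card = 3 :=
    fun c hc => by
      rw [Finset.card_insert_of_notMem (Finset.mem_compl.1 hc), Finset.card_pair hab]
  rw [← hc]
  symm
  refine Finset.card_bij (fun c _ => pairsOf (insert c {a, b})) ?_ ?_ ?_
  · intro c hc
    refine Finset.mem_filter.2 ⟨mem_triangleTriples.2 ⟨_, hcard c hc, rfl⟩, ?_⟩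
    rw [mk_mem_pairsOf]
    simp [hab]
  · intro c hc c' hc' h
    have := pairsOf_injOn (hcard c hc) (hcard c' hc') h
    have hmem : c ∈ insert c' ({a, b} : Finset V) := this ▸ Finset.mem_insert_self c _
    exact (Finset.mem_insert.1 hmem).resolve_right (Finset.mem_compl.1 hc)
  · intro T hT
    rw [Finset.mem_filter, mem_triangleTriples] at hT
    obtain ⟨⟨t, ht, rfl⟩, hab'⟩ := hT
    rw [mk_mem_pairsOf] at hab'
    have hsub : ({a, b} : Finset V) ⊆ t := by
      intro x hx
      rw [Finset.mem_insert, Finset.mem_singleton] at hx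
      rcases hx with rfl | rfl
      · exact hab'.1
      · exact hab'.2.1
    obtain ⟨c, hc⟩ := Finset.card_eq_one.1 (show (t \ {a, b}).card = 1 by
      rw [Finset.card_sdiff_of_subset hsub, ht, Finset.card_pair hab])
    refine ⟨c, ?_, ?_⟩
    · have : c ∈ t \ {a, b} := hc ▸ Finset.mem_singleton_self c
      exact Finset.mem_compl.2 (Finset.mem_sdiff.1 this).2
    · rw [Finset.insert_eq, ← hc, Finset.sdiff_union_of_subset hsub]

variable (V) in
theorem isLinearTripleSystem_triangleTriples [Fintype V] :
    IsLinearTripleSystem (pairsOf (Finset.univ : Finset V)) (triangleTriples V)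
      (Fintype.card V - 2) where
  subset T hT := by
    obtain ⟨t, -, rfl⟩ := mem_triangleTriples.1 hT
    exact pairsOf_mono (Finset.subset_univ t)
  card_eq T hT := by
    obtain ⟨t, ht, rfl⟩ := mem_triangleTriples.1 hT
    rw [card_pairsOf, ht]
    rfl
  linear T hT T' hT' e f hef he hf he' hf' := by
    obtain ⟨t, ht, rfl⟩ := mem_triangleTriples.1 hT
    obtain ⟨t', ht', rfl⟩ := mem_triangleTriples.1 hT'
    rw [eq_of_mem_pairsOf ht ht' hef he hf he' hf']
  degree e he := card_triangleTriples_through he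

theorem SimpleGraph.isNClique_fromEdgeSet_iff {A : Finset (Sym2 V)} {k : ℕ} {t : Finset V} :
    (SimpleGraph.fromEdgeSet (A : Set (Sym2 V))).IsNClique k t ↔ t.card = k ∧ pairsOf t ⊆ A := by
  rw [SimpleGraph.isNClique_iff, and_comm]
  refine and_congr_right fun _ => ⟨fun h e he => ?_, fun h x hx y hy hxy => ?_⟩
  · induction e with | _ x y =>
    rw [mk_mem_pairsOf] at he
    exact ((SimpleGraph.fromEdgeSet_adj _).1 (h he.1 he.2.1 he.2.2)).1
  · exact (SimpleGraph.fromEdgeSet_adj _).2 ⟨h (mk_mem_pairsOf.2 ⟨hx, hy, hxy⟩), hxy⟩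

theorem subsingleton_inter_iff {s t : Finset V} :
    ((s : Set V) ∩ (t : Set V)).Subsingleton ↔ Disjoint (pairsOf s) (pairsOf t) := by
  rw [Finset.disjoint_left]
  constructor
  · intro h e hs ht
    induction e with | _ x y =>
    rw [mk_mem_pairsOf] at hs ht
    exact hs.2.2 (h ⟨hs.1, ht.1⟩ ⟨hs.2.1, ht.2.1⟩)
  · intro h x hx y hy
    by_contra hxy
    exact h (mk_mem_pairsOf.2 ⟨hx.1, hy.1, hxy⟩) (mk_mem_pairsOf.2 ⟨hx.2, hy.2, hxy⟩)

/-- The triangle matching number of the graph with a given edge set. -/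
noncomputable def matchingOfEdges (A : Finset (Sym2 V)) : ℕ :=
  (SimpleGraph.fromEdgeSet (A : Set (Sym2 V))).triangleMatchingNumber

theorem isTriangleMatching_fromEdgeSet_iff {A : Finset (Sym2 V)} {M : Finset (Finset V)} :
    (SimpleGraph.fromEdgeSet (A : Set (Sym2 V))).IsTriangleMatching M ↔
      (∀ t ∈ M, t.card = 3 ∧ pairsOf t ⊆ A) ∧
        (M : Set (Finset V)).Pairwise fun s t => Disjoint (pairsOf s) (pairsOf t) := by
  simp only [SimpleGraph.IsTriangleMatching, SimpleGraph.isNClique_fromEdgeSet_iff,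
    subsingleton_inter_iff]

variable [Finite V]

theorem exists_matchingOfEdges (A : Finset (Sym2 V)) : ∃ M : Finset (Finset V),
    ((∀ t ∈ M, t.card = 3 ∧ pairsOf t ⊆ A) ∧
      (M : Set (Finset V)).Pairwise fun s t => Disjoint (pairsOf s) (pairsOf t)) ∧
    M.card = matchingOfEdges A := by
  obtain ⟨M, hM, hc⟩ := (SimpleGraph.isGreatest_triangleMatchingNumber
    (SimpleGraph.fromEdgeSet (A : Set (Sym2 V)))).1
  exact ⟨M, isTriangleMatching_fromEdgeSet_iff.1 hM, hc⟩

theorem card_le_matchingOfEdges {A : Finset (Sym2 V)} {M : Finset (Finset V)}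
    (h : ∀ t ∈ M, t.card = 3 ∧ pairsOf t ⊆ A)
    (h' : (M : Set (Finset V)).Pairwise fun s t => Disjoint (pairsOf s) (pairsOf t)) :
    M.card ≤ matchingOfEdges A :=
  (SimpleGraph.isGreatest_triangleMatchingNumber _).2
    ⟨M, isTriangleMatching_fromEdgeSet_iff.2 ⟨h, h'⟩, rfl⟩

theorem matchingOfEdges_mono {A B : Finset (Sym2 V)} (hAB : A ⊆ B) :
    matchingOfEdges A ≤ matchingOfEdges B := by
  obtain ⟨M, hM, hc⟩ := exists_matchingOfEdges A
  rw [← hc]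
  exact card_le_matchingOfEdges (fun t ht => ⟨(hM.1 t ht).1, (hM.1 t ht).2.trans hAB⟩) hM.2

theorem matchingOfEdges_sdiff_add_one_le {A : Finset (Sym2 V)} {t : Finset V} (ht : t.card = 3)
    (htA : pairsOf t ⊆ A) : matchingOfEdges (A \ pairsOf t) + 1 ≤ matchingOfEdges A := by
  obtain ⟨M, hM, hc⟩ := exists_matchingOfEdges (A \ pairsOf t)
  have hdisj : ∀ s ∈ M, Disjoint (pairsOf s) (pairsOf t) := fun s hs =>
    (Finset.subset_sdiff.1 (hM.1 s hs).2).2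
  have htM : t ∉ M := fun h => by
    have := hdisj t h
    rw [disjoint_self, Finset.bot_eq_empty, ← Finset.card_eq_zero, card_pairsOf, ht] at this
    exact absurd this (by decide)
  rw [← hc, ← Finset.card_insert_of_notMem htM]
  refine card_le_matchingOfEdges (fun s hs => ?_) ?_
  · rcases Finset.mem_insert.1 hs with rfl | hs
    · exact ⟨ht, htA⟩
    · exact ⟨(hM.1 s hs).1, (hM.1 s hs).2.trans Finset.sdiff_subset⟩
  · rw [Finset.coe_insert, Set.pairwise_insert]
    exact ⟨hM.2, fun s hs _ => ⟨(hdisj s hs).symm, hdisj s hs⟩⟩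

/-- At most one triangle of an edge-disjoint family contains `e`; dropping it leaves a matching
inside `A`. -/
theorem matchingOfEdges_insert_le (A : Finset (Sym2 V)) (e : Sym2 V) :
    matchingOfEdges (insert e A) ≤ matchingOfEdges A + 1 := by
  obtain ⟨M, hM, hc⟩ := exists_matchingOfEdges (insert e A)
  rw [← hc]
  have hA : ∀ s ∈ M, e ∉ pairsOf s → pairsOf s ⊆ A := fun s hs he =>
    (Finset.subset_insert_iff_of_notMem he).1 (hM.1 s hs).2
  by_cases h : ∃ t ∈ M, e ∈ pairsOf t
  · obtain ⟨t, ht, het⟩ := h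
    have : (M.erase t).card ≤ matchingOfEdges A := by
      refine card_le_matchingOfEdges (fun s hs => ?_) (hM.2.mono (Finset.erase_subset t M))
      rw [Finset.mem_erase] at hs
      exact ⟨(hM.1 s hs.2).1, hA s hs.2 fun hes =>
        Finset.disjoint_left.1 (hM.2 hs.2 ht hs.1) hes het⟩
    rw [Finset.card_erase_of_mem ht] at this
    omega
  · push Not at h
    exact (card_le_matchingOfEdges (fun s hs => ⟨(hM.1 s hs).1, hA s hs (h s hs)⟩) hM.2).trans
      (Nat.le_succ _)

theorem abs_matchingOfEdges_insert_sub_le (A : Finset (Sym2 V)) (e : Sym2 V) :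
    |(matchingOfEdges (insert e A) : ℝ) - matchingOfEdges A| ≤ 1 := by
  have h1 : (matchingOfEdges A : ℝ) ≤ matchingOfEdges (insert e A) := by
    exact_mod_cast matchingOfEdges_mono (Finset.subset_insert e A)
  have h2 : (matchingOfEdges (insert e A) : ℝ) ≤ matchingOfEdges A + 1 := by
    exact_mod_cast matchingOfEdges_insert_le A e
  rw [abs_le]
  constructor <;> linarith

/-- Probabilities in the binomial random graph as finite sums over edge sets. -/
theorem SimpleGraph.binomialRandom_real_eq_bernoulliSum {V : Type*} [DecidableEq V] [Fintype V]
    (p : unitInterval) (S : Set (SimpleGraph V)) [DecidablePred (· ∈ S)] :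
    (SimpleGraph.binomialRandom V p).real S =
      bernoulliSum p (pairsOf (Finset.univ : Finset V)) fun A =>
        if SimpleGraph.fromEdgeSet (A : Set (Sym2 V)) ∈ S then 1 else 0 := by
  classical
  have : MeasurableSingletonClass (SimpleGraph V) := ⟨fun G => by
    have : ({G} : Set (SimpleGraph V)) = SimpleGraph.edgeSet ⁻¹' {G.edgeSet} := by
      ext H
      simp
    rw [this]
    exact SimpleGraph.measurable_edgeSet (measurableSet_singleton _)⟩
  have hS : S = ((Finset.univ.filter (· ∈ S) : Finset (SimpleGraph V)) : Set (SimpleGraph V)) := by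
    ext; simp
  have hpair : ∀ e : Sym2 V, e ∈ pairsOf (Finset.univ : Finset V) ↔ ¬ e.IsDiag := fun e => by
    induction e with | _ x y => simp [mk_mem_pairsOf]
  have hcoe : ∀ G : SimpleGraph V,
      ((pairsOf (Finset.univ : Finset V)).filter (· ∈ G.edgeSet) : Set (Sym2 V)) = G.edgeSet :=
    fun G => by
      ext e
      rw [Finset.coe_filter]
      exact ⟨fun h => h.2, fun h => ⟨(hpair e).2 (G.not_isDiag_of_mem_edgeSet h), h⟩⟩
  conv_lhs => rw [hS]
  rw [← MeasureTheory.sum_measureReal_singleton, Finset.sum_filter, bernoulliSum]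
  -- Graphs correspond to sets of non-diagonal pairs, with equal point masses on both sides.
  refine Finset.sum_bij' (fun G _ => (pairsOf (Finset.univ : Finset V)).filter (· ∈ G.edgeSet))
    (fun A _ => SimpleGraph.fromEdgeSet (A : Set (Sym2 V))) ?_ ?_ ?_ ?_ ?_
  · exact fun G _ => Finset.mem_powerset.2 (Finset.filter_subset _ _)
  · exact fun A _ => Finset.mem_univ _
  · intro G _
    simp only [hcoe, SimpleGraph.fromEdgeSet_edgeSet]
  · intro A hA
    rw [Finset.mem_powerset] at hA
    ext e
    simp only [Finset.mem_filter, SimpleGraph.edgeSet_fromEdgeSet, Set.mem_sdiff, Finset.mem_coe,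
      Sym2.mem_diagSet]
    exact ⟨fun h => h.2.1, fun h => ⟨hA h, h, (hpair e).1 (hA h)⟩⟩
  · intro G _
    have h1 : G.edgeSet.ncard = ((pairsOf (Finset.univ : Finset V)).filter (· ∈ G.edgeSet)).card := by
      rw [← Set.ncard_coe_finset, hcoe]
    rw [hcoe, SimpleGraph.fromEdgeSet_edgeSet, MeasureTheory.measureReal_def,
      SimpleGraph.binomialRandom_singleton, h1, Finset.card_sdiff_of_subset (Finset.filter_subset _ _),
      card_pairsOf, Finset.card_univ, Nat.card_eq_fintype_card]
    split_ifs <;> simp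

end GraphTriangles

/-! ### Choice of parameters and passage to the limit. -/

section TriangleMatchingAsymptotics

theorem xi_eq {x : ℝ} (hx : 0 ≤ x) : xi x = (1 / 3) * (1 - (√(1 + 2 * x))⁻¹) := by
  rw [xi, Real.rpow_neg (by positivity), ← Real.sqrt_eq_rpow, add_comm]

theorem xi_mono {x y : ℝ} (hx : 0 ≤ x) (hxy : x ≤ y) : xi x ≤ xi y := by
  rw [xi_eq hx, xi_eq (hx.trans hxy)]
  have h1 : 0 < √(1 + 2 * x) := Real.sqrt_pos.2 (by positivity)
  gcongr

theorem xi_pos {x : ℝ} (hx : 0 < x) : 0 < xi x := by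
  rw [xi_eq hx.le]
  have h1 : 1 < √(1 + 2 * x) := by
    rw [Real.lt_sqrt zero_le_one]
    linarith
  have h2 := inv_lt_one_of_one_lt₀ h1
  linarith

/-- A quantitative form of the lower bound on the triangle matching number of `G(n, p)`. -/
theorem binomialRandom_triangleMatchingNumber_lower (n : ℕ) (hn : 3 ≤ n) (p : unitInterval)
    {c C ε : ℝ} (hc : 0 < c) (hε : 0 < ε) (hcd : c ≤ expectedTrianglesOnEdge n p)
    (hdC : expectedTrianglesOnEdge n p ≤ C) (hCN : 2 * (27 * C + 1) ≤ n.choose 3) (j K : ℕ)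
    (hK1 : 1 < K) (hj : C * Real.exp (-(j / (2 * (27 * C + 1)))) ≤ xi c * ε / 2)
    (hK : (1 / 2 : ℝ) ^ K ≤ xi c * ε / 2)
    (hE : hierarchyError C p (n.choose 3) (3 ^ j * K) ≤ (1 / 2) ^ (3 ^ j * K))
    (hm : 9 / (xi c * ε) ^ 2 ≤ ε * expectedEdges n p) :
    1 - ε ≤ (SimpleGraph.binomialRandom (Fin n) p).real
      {G : SimpleGraph (Fin n) | (1 - ε) * xi (expectedTrianglesOnEdge n p) * expectedEdges n p <
        (G.triangleMatchingNumber : ℝ)} := by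
  classical
  set d := expectedTrianglesOnEdge n p with hd
  set m := expectedEdges n p with hmdef
  have hp0 : (0 : ℝ) ≤ p := p.2.1
  have hp1 : (p : ℝ) ≤ 1 := p.2.2
  have hp : (0 : ℝ) < p := by
    refine lt_of_le_of_ne hp0 fun h0 => ?_
    rw [hd, expectedTrianglesOnEdge, ← h0] at hcd
    linarith
  have hC : 0 < C := hc.trans_le (hcd.trans hdC)
  have hκ := xi_pos hc
  have hκd : xi c ≤ xi d := xi_mono hc.le hcd
  have hsys := isLinearTripleSystem_triangleTriples (Fin n)
  have hcard : (triangleTriples (Fin n)).card = n.choose 3 := by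
    rw [card_triangleTriples, Fintype.card_fin]
  have hN : (triangleTriples (Fin n)).Nonempty := by
    rw [← Finset.card_pos, hcard]
    exact Nat.choose_pos hn
  have hX : ((pairsOf (Finset.univ : Finset (Fin n))).card : ℝ) * p = m := by
    rw [card_pairsOf, Finset.card_univ, Fintype.card_fin, hmdef, expectedEdges]
  have hdD : d = ((Fintype.card (Fin n) - 2 : ℕ) : ℝ) * (p : ℝ) ^ 2 := by
    rw [hd, expectedTrianglesOnEdge, Fintype.card_fin, Nat.cast_sub (by omega)]
    norm_num
  have hm0 : 0 < m := by
    rw [← hX]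
    refine mul_pos ?_ hp
    rw [card_pairsOf, Finset.card_univ, Fintype.card_fin]
    exact_mod_cast Nat.choose_pos (by omega)
  have hexp := hsys.le_expectation hN hp hp1 hdD hdC (by rw [hcard]; linarith)
    (by rw [hcard]; exact hCN) j K hK1 (by rw [hcard]; exact hE)
    (ν := fun A => (matchingOfEdges A : ℝ)) (fun A => Nat.cast_nonneg _) (fun A T hT hTA => by
      obtain ⟨t, ht, rfl⟩ := mem_triangleTriples.1 hT
      exact_mod_cast matchingOfEdges_sdiff_add_one_le ht hTA)
  set μ := bernoulliSum p (pairsOf (Finset.univ : Finset (Fin n)))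
    fun A => (matchingOfEdges A : ℝ) with hμ
  -- Of the relative error `ε`, one third goes to the expectation and one third to the fluctuation
  -- `s`; the rest is slack. Using `xi c ≤ xi d` keeps the parameters uniform in `d`.
  have hμlo : m * (xi d - xi c * ε / 3) ≤ μ := by
    have h1 : 3 * xi d = 1 - (√(1 + 2 * d))⁻¹ := by rw [xi_eq (hc.le.trans hcd)]; ring
    rw [hX, ← h1] at hexp
    have h2 : m * (3 * xi d - xi c * ε) ≤ m * (3 * xi d -
        C * Real.exp (-(j / (2 * (27 * C + 1)))) - (1 / 2) ^ K) :=
      mul_le_mul_of_nonneg_left (by linarith) hm0.le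
    linarith
  set s := m * (xi c * ε / 3) with hs
  have hs0 : 0 < s := by positivity
  have htail := bernoulliSum_lower_tail hp0 hp1 (pairsOf (Finset.univ : Finset (Fin n)))
    (fun A => (matchingOfEdges A : ℝ))
    (fun e _ A _ => abs_matchingOfEdges_insert_sub_le A e) hs0
  rw [hX, ← hμ] at htail
  have htail2 : m / s ^ 2 ≤ ε := by
    rw [div_le_iff₀ (by positivity), hs]
    rw [div_le_iff₀ (by positivity)] at hm
    have := mul_le_mul_of_nonneg_left hm hm0.le
    linarith
  rw [SimpleGraph.binomialRandom_real_eq_bernoulliSum]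
  have hsplit := bernoulliSum_sub p (pairsOf (Finset.univ : Finset (Fin n))) (fun _ => 1)
    (fun A => if (matchingOfEdges A : ℝ) ≤ μ - s then 1 else 0)
  rw [bernoulliSum_const] at hsplit
  calc 1 - ε ≤ _ := by linarith [htail.trans htail2]
    _ = _ := hsplit.symm
    _ ≤ _ := by
      refine bernoulliSum_mono hp0 hp1 fun A _ => ?_
      by_cases h : (matchingOfEdges A : ℝ) ≤ μ - s
      · simp only [h, if_true, sub_self]
        split_ifs <;> norm_num
      · have hlt : (1 - ε) * xi d * m < (matchingOfEdges A : ℝ) := by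
          have h1 : m * ε * xi c ≤ m * ε * xi d := by gcongr
          have h2 : 0 < m * ε * xi d := mul_pos (mul_pos hm0 hε) (hκ.trans_le hκd)
          have h3 := not_le.1 h
          linarith [show s = m * (xi c * ε / 3) from hs]
        have hmem : SimpleGraph.fromEdgeSet (A : Set (Sym2 (Fin n))) ∈
            {G : SimpleGraph (Fin n) | (1 - ε) * xi d * m < (G.triangleMatchingNumber : ℝ)} := hlt
        simp [h, hmem]

/-- The lower bound holds with any fixed relative error, with probability close to one. -/
theorem eventually_triangleMatchingNumber_lower (p : ℕ → unitInterval) {c C : ℝ} (hc : 0 < c)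
    (hd : ∀ᶠ n in atTop, c ≤ expectedTrianglesOnEdge n (p n : ℝ) ∧
      expectedTrianglesOnEdge n (p n : ℝ) ≤ C) {ε : ℝ} (hε : 0 < ε) :
    ∀ᶠ n in atTop, 1 - ε ≤ (SimpleGraph.binomialRandom (Fin n) (p n)).real
      {G : SimpleGraph (Fin n) | (1 - ε) * xi (expectedTrianglesOnEdge n (p n : ℝ)) *
        expectedEdges n (p n : ℝ) < (G.triangleMatchingNumber : ℝ)} := by
  have hC : 0 < C := by
    obtain ⟨n, hn⟩ := hd.exists
    exact hc.trans_le (hn.1.trans hn.2)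
  have hη : 0 < xi c * ε / 2 := by have := xi_pos hc; positivity
  -- The run length `j` and the cutoff `K` depend only on `c`, `C` and `ε`. Hence `hierarchyError`
  -- is evaluated at the fixed size `3 ^ j * K` and tends to zero with `n`.
  obtain ⟨j, hj⟩ : ∃ j : ℕ, C * Real.exp (-(j / (2 * (27 * C + 1)))) ≤ xi c * ε / 2 := by
    have h1 : Tendsto (fun j : ℕ => C * Real.exp (-((j : ℝ) / (2 * (27 * C + 1))))) atTop
        (𝓝 (C * 0)) :=
      (Real.tendsto_exp_neg_atTop_nhds_zero.comp
        (tendsto_natCast_atTop_atTop.atTop_div_const (by positivity))).const_mul C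
    rw [mul_zero] at h1
    exact (h1.eventually_le_const hη).exists
  obtain ⟨K, hK1, hK⟩ : ∃ K : ℕ, 1 < K ∧ (1 / 2 : ℝ) ^ K ≤ xi c * ε / 2 :=
    ((eventually_gt_atTop 1).and ((tendsto_pow_atTop_nhds_zero_of_lt_one (by norm_num)
      (by norm_num : (1 / 2 : ℝ) < 1)).eventually_le_const hη)).exists
  have hn2 : Tendsto (fun n : ℕ => (n : ℝ) - 2) atTop atTop :=
    tendsto_atTop_add_const_right _ _ tendsto_natCast_atTop_atTop
  have hN : Tendsto (fun n : ℕ => (n.choose 3 : ℝ)) atTop atTop := by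
    refine tendsto_atTop_mono' _ ?_ hn2
    filter_upwards [eventually_ge_atTop 3] with n hn
    -- Double counting gives `3 * n.choose 3 = n.choose 2 * (n - 2)`, which is at least `3 * (n -
    -- 2)`.
    have h1 := (isLinearTripleSystem_triangleTriples (Fin n)).three_mul_card
    rw [card_triangleTriples, card_pairsOf, Finset.card_univ, Fintype.card_fin] at h1
    have h2 : 3 ≤ n.choose 2 := Nat.choose_le_choose 2 hn
    have h3 : n ≤ n.choose 3 + 2 := by
      have := Nat.mul_le_mul_right (n - 2) h2
      omega
    have h4 : (n : ℝ) ≤ n.choose 3 + 2 := by exact_mod_cast h3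
    linarith
  have hp : Tendsto (fun n => (p n : ℝ)) atTop (𝓝 0) := by
    have h1 : Tendsto (fun n => (p n : ℝ) ^ 2) atTop (𝓝 0) := by
      refine squeeze_zero' (Eventually.of_forall fun n => sq_nonneg _) ?_
        (hn2.const_div_atTop C)
      filter_upwards [hd, eventually_ge_atTop 3] with n hn hn3
      have hn3' : (3 : ℝ) ≤ n := by exact_mod_cast hn3
      rw [le_div_iff₀ (by linarith), mul_comm]
      exact hn.2
    have h2 := h1.sqrt
    rw [Real.sqrt_zero] at h2
    refine h2.congr fun n => Real.sqrt_sq (p n).2.1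
  have hE : Tendsto (fun n => hierarchyError C (p n) (n.choose 3) (3 ^ j * K)) atTop (𝓝 0) := by
    have := (hp.const_mul (16 * ((3 ^ j * K : ℕ) : ℝ) ^ 3)).add (hN.const_div_atTop
      ((C * ((3 ^ j * K : ℕ) : ℝ) + ((3 ^ j * K : ℕ) : ℝ) ^ 2) ^ 2))
    rwa [mul_zero, add_zero] at this
  have hm : Tendsto (fun n => ε * expectedEdges n (p n : ℝ)) atTop atTop := by
    refine Tendsto.const_mul_atTop hε (tendsto_atTop_mono' _ ?_ (hn2.const_mul_atTop (half_pos hc)))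
    filter_upwards [hd, eventually_ge_atTop 3] with n hn hn3
    have hn3' : (3 : ℝ) ≤ n := by exact_mod_cast hn3
    have hp0 : (0 : ℝ) ≤ p n := (p n).2.1
    have hpp : (p n : ℝ) ^ 2 ≤ p n := by
      rw [sq]; exact mul_le_of_le_one_left hp0 (p n).2.2
    -- From `c ≤ (n - 2) p² ≤ n p` follows `m ≥ c (n - 1) / 2`, so the expected number of edges
    -- diverges.
    have h1 : c ≤ n * (p n : ℝ) := by
      have h2 := hn.1
      rw [expectedTrianglesOnEdge] at h2
      have h3 : ((n : ℝ) - 2) * (p n : ℝ) ^ 2 ≤ n * (p n : ℝ) :=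
        mul_le_mul (by linarith) hpp (sq_nonneg _) (by positivity)
      linarith
    rw [expectedEdges, Nat.cast_choose_two]
    have h4 := mul_le_mul_of_nonneg_right h1 (by linarith : 0 ≤ (n : ℝ) - 1)
    linarith
  filter_upwards [hd, eventually_ge_atTop 3, hN.eventually_ge_atTop (2 * (27 * C + 1)),
    hE.eventually_le_const (show (0 : ℝ) < (1 / 2) ^ (3 ^ j * K) by positivity),
    hm.eventually_ge_atTop (9 / (xi c * ε) ^ 2)] with n h1 h2 h3 h4 h5
  exact binomialRandom_triangleMatchingNumber_lower n h2 (p n) hc hε h1.1 h1.2 h3 j K hK1 hj hK h4 h5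

/-- A property which eventually holds for each fixed positive error holds along some sequence of
errors tending to zero. -/
theorem exists_tendsto_zero_of_forall_eventually (Q : ℕ → ℝ → Prop)
    (h : ∀ ε > 0, ∀ᶠ n in atTop, Q n ε) :
    ∃ δ : ℕ → ℝ, Tendsto δ atTop (𝓝 0) ∧ ∀ᶠ n in atTop, Q n (δ n) := by
  have hex : ∀ n : ℕ, ∃ δ : ℝ, ((∃ ε > 0, Q n ε) → Q n δ) ∧ 0 ≤ δ ∧
      ∀ ε > 0, Q n ε → δ ≤ ε + 1 / ((n : ℝ) + 1) := fun n => by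
    by_cases hne : ∃ ε > 0, Q n ε
    · have hS : ({ε | 0 < ε ∧ Q n ε} : Set ℝ).Nonempty := hne
      -- The infimum of the admissible errors need not be attained, so an admissible error within `1
      -- / (n + 1)` of it is taken.
      obtain ⟨δ, hδ, hlt⟩ := exists_lt_of_csInf_lt hS
        (lt_add_of_pos_right _ (Nat.one_div_pos_of_nat (α := ℝ) (n := n)))
      refine ⟨δ, fun _ => hδ.2, hδ.1.le, fun ε hε hQ => hlt.le.trans ?_⟩
      have : sInf {ε | 0 < ε ∧ Q n ε} ≤ ε := csInf_le ⟨0, fun x hx => hx.1.le⟩ ⟨hε, hQ⟩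
      linarith
    · exact ⟨0, fun h => absurd h hne, le_rfl, fun ε hε hQ => absurd ⟨ε, hε, hQ⟩ hne⟩
  choose δ h1 h2 h3 using hex
  refine ⟨δ, ?_, (h 1 one_pos).mono fun n hn => h1 n ⟨1, one_pos, hn⟩⟩
  refine tendsto_order.2 ⟨fun a ha => Eventually.of_forall fun n => ha.trans_le (h2 n),
    fun a ha => ?_⟩
  filter_upwards [h (a / 2) (half_pos ha), (tendsto_one_div_add_atTop_nhds_zero_nat
    (𝕜 := ℝ)).eventually_lt_const (half_pos ha)] with n hn hn'
  linarith [h3 n (a / 2) (half_pos ha) hn]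

end TriangleMatchingAsymptotics

theorem mainTheorem3 (p : ℕ → unitInterval)
    (hd : (fun n : ℕ => expectedTrianglesOnEdge n (p n : ℝ)) =Θ[atTop] (fun _ : ℕ => (1 : ℝ))) :
    ∃ δ : ℕ → ℝ, Tendsto δ atTop (𝓝 0) ∧
      Tendsto
        (fun n : ℕ => (SimpleGraph.binomialRandom (Fin n) (p n))
          {G : SimpleGraph (Fin n) |
            (1 - δ n) * xi (expectedTrianglesOnEdge n (p n : ℝ)) * expectedEdges n (p n : ℝ)
              < (G.triangleMatchingNumber : ℝ)})
        atTop (𝓝 1) := by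
  obtain ⟨C, hC⟩ := hd.1.bound
  obtain ⟨B, hB0, hB⟩ := hd.2.exists_pos
  have hB := hB.bound
  have hbounds : ∀ᶠ n : ℕ in atTop, B⁻¹ ≤ expectedTrianglesOnEdge n (p n : ℝ) ∧
      expectedTrianglesOnEdge n (p n : ℝ) ≤ C := by
    filter_upwards [hC, hB, eventually_ge_atTop 2] with n h1 h2 hn
    have hn' : (2 : ℝ) ≤ n := by exact_mod_cast hn
    have h0 : 0 ≤ expectedTrianglesOnEdge n (p n : ℝ) :=
      mul_nonneg (by linarith) (sq_nonneg _)
    rw [norm_one, mul_one, Real.norm_of_nonneg h0] at h1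
    rw [norm_one, Real.norm_of_nonneg h0] at h2
    exact ⟨(inv_le_iff_one_le_mul₀' hB0).2 h2, h1⟩
  obtain ⟨δ, hδ, hQ⟩ := exists_tendsto_zero_of_forall_eventually
    (fun n ε => 1 - ε ≤ (SimpleGraph.binomialRandom (Fin n) (p n)).real
      {G : SimpleGraph (Fin n) | (1 - ε) * xi (expectedTrianglesOnEdge n (p n : ℝ)) *
        expectedEdges n (p n : ℝ) < (G.triangleMatchingNumber : ℝ)})
    (fun ε hε => eventually_triangleMatchingNumber_lower p (inv_pos.2 hB0) hbounds hε)
  refine ⟨δ, hδ, ?_⟩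
  rw [← ENNReal.tendsto_toReal_iff (fun n => MeasureTheory.measure_ne_top _ _) ENNReal.one_ne_top]
  -- The same `δ n` bounds both the relative error and the failure probability, so squeezing
  -- finishes.
  refine tendsto_of_tendsto_of_tendsto_of_le_of_le' (g := fun n => 1 - δ n) (h := fun _ => 1)
    (by simpa using hδ.const_sub 1) (by simp) hQ (Eventually.of_forall fun n => ?_)
  exact MeasureTheory.measureReal_le_one
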